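/- Let $\Omega=\mathbb{R}\times[-1,1]$. For a vorticity $\omega:\Omega\to\mathbb{R}$ let $\psi$ be its stream function, i.e. the bounded solution of $-\Delta\psi=\omega$ in $\mathbb{R}\times(-1,1)$, $\psi=0$ on $\{y=\pm1\}$, and let $u=(u^x,u^y)=(\partial_y\psi,-\partial_x\psi)$ be the velocity it generates. A function $\omega=\omega(x,y)$ is called a traveling wave of speed $c\in\mathbb{R}$ if $w(t,x,y)=\omega(x-ct,y)$ solves the two-dimensional Euler equations near the Couette flow $(y,0)$, $$\partial_t w+y\,\partial_x w+u\cdot\nabla w=0\quad\text{in }\Omega,$$ where $u$ is generated by $w(t,\cdot)$; equivalently $(y-c+u^x)\partial_x\omega+u^y\partial_y\omega=0$ with $u$ generated by $\omega$. For $\alpha>0$ put $$\|\omega\|_{C^{1,\alpha}(\Omega)}=\sup_\Omega|\omega|+\sup_\Omega|\nabla\omega|+\sup_{z\neq z'}\frac{|\nabla\omega(z)-\nabla\omega(z')|}{|z-z'|^\alpha}.$$ **Theorem (Rigidity: Hölder scale).** For every $\alpha>0$ there exists $\epsilon_\alpha>0$, depending only on $\alpha$, such that the following holds. If $c\in\mathbb{R}$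 and $\omega\in C^{1,\alpha}(\Omega)\cap L^2(\Omega)$ is a traveling wave of speed $c$ with $$\|\omega\|_{C^{1,\alpha}(\Omega)}\le\epsilon_\alpha,$$ then $\omega\equiv0$ on $\Omega$. -/

import Mathlib

open MeasureTheory Set
open scoped ENNReal

noncomputable section

namespace Couette

/-- The closed infinite channel `ℝ × [-1, 1]`. -/
def channel : Set (ℝ × ℝ) := univ ×ˢ Icc (-1) 1

/-- The open channel `ℝ × (-1, 1)`. -/
def openChannel : Set (ℝ × ℝ) := univ ×ˢ Ioo (-1) 1

/-- The horizontal partial derivative. It is only evaluated at points of the open channel. -/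
def dx (f : ℝ × ℝ → ℝ) (z : ℝ × ℝ) : ℝ := fderiv ℝ f z (1, 0)

/-- The vertical partial derivative. It is only evaluated at points of the open channel. -/
def dy (f : ℝ × ℝ → ℝ) (z : ℝ × ℝ) : ℝ := fderiv ℝ f z (0, 1)

/-- The Euclidean length of a vector of the plane (the norm that Mathlib puts on `ℝ × ℝ` is the
maximum norm). -/
def euclid (v : ℝ × ℝ) : ℝ := Real.sqrt (v.1 ^ 2 + v.2 ^ 2)

/-- The gradient `(∂ₓ f, ∂_y f)`. -/
def grad (f : ℝ × ℝ → ℝ) (z : ℝ × ℝ) : ℝ × ℝ := (dx f z, dy f z)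

/-- The norm
`‖f‖_{C^{1,α}} = sup |f| + sup |∇f| + sup_{z ≠ z'} |∇f(z) - ∇f(z')| / |z - z'|^α`,
with values in `[0, ∞]`. -/
def holderNorm (α : ℝ) (f : ℝ × ℝ → ℝ) : ℝ≥0∞ :=
  (⨆ z ∈ channel, ENNReal.ofReal |f z|)
    + (⨆ z ∈ openChannel, ENNReal.ofReal (euclid (grad f z)))
    + ⨆ z ∈ openChannel, ⨆ z' ∈ openChannel, ⨆ _ : z ≠ z',
        ENNReal.ofReal (euclid (grad f z - grad f z') / euclid (z - z') ^ α)

/-- Membership in `C^{1,α}` of the closed channel: `f` is continuous up to the boundary, `C¹` inside,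
and its `C^{1,α}` norm is finite (so that the gradient extends continuously to the boundary). -/
structure MemHolder (α : ℝ) (f : ℝ × ℝ → ℝ) : Prop where
  continuousOn : ContinuousOn f channel
  contDiffOn : ContDiffOn ℝ 1 f openChannel
  norm_lt_top : holderNorm α f < ∞

/-- `ψ` is the stream function of the vorticity `ω`: the bounded classical solution of the Dirichlet
problem `-Δψ = ω` in the open channel, `ψ = 0` on `y = ±1`. Boundedness singles out the potential of
`ω` for the Dirichlet Green function among all solutions, such as those that differ from it by a
multiple of `exp (π x / 2) * cos (π y / 2)`. -/
structure IsStreamFunction (ω ψ : ℝ × ℝ → ℝ) : Prop where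
  contDiffOn : ContDiffOn ℝ 2 ψ openChannel
  continuousOn : ContinuousOn ψ channel
  bounded : ∃ M : ℝ, ∀ z ∈ channel, |ψ z| ≤ M
  bottom : ∀ x : ℝ, ψ (x, -1) = 0
  top : ∀ x : ℝ, ψ (x, 1) = 0
  poisson : ∀ z ∈ openChannel, -(dx (dx ψ) z + dy (dy ψ) z) = ω z

/-- The velocity `∇^⊥ ψ = (∂_y ψ, -∂ₓ ψ)`. -/
def velocity (ψ : ℝ × ℝ → ℝ) (z : ℝ × ℝ) : ℝ × ℝ := (dy ψ z, -dx ψ z)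

/-- `w` is a classical solution of the two-dimensional Euler equations for vorticity perturbations
of the Couette flow `(y, 0)`, that is `∂ₜ w + y ∂ₓ w + u · ∇ w = 0`, where `u` is the velocity
generated by `w`. -/
def IsEulerSolution (w : ℝ → ℝ × ℝ → ℝ) : Prop :=
  ContDiffOn ℝ 1 (fun p : ℝ × (ℝ × ℝ) => w p.1 p.2) (univ ×ˢ openChannel) ∧
  ∃ ψ : ℝ → ℝ × ℝ → ℝ,
    (∀ t : ℝ, IsStreamFunction (w t) (ψ t)) ∧
    ∀ t : ℝ, ∀ z ∈ openChannel,
      deriv (fun τ => w τ z) t + z.2 * dx (w t) z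
        + ((velocity (ψ t) z).1 * dx (w t) z + (velocity (ψ t) z).2 * dy (w t) z) = 0

/-- `ω` is the profile of a traveling wave of speed `c`: `ω (x - c t, y)` solves the equation. -/
def IsTravelingWave (c : ℝ) (ω : ℝ × ℝ → ℝ) : Prop :=
  IsEulerSolution (fun t z => ω (z.1 - c * t, z.2))

end Couette

end

noncomputable section

namespace Couette

open Filter Topology

/-! Write φ = ∂ₓψ. It vanishes on the walls and satisfies -Δφ = ∂ₓω, so formally ∫|∇φ|² = ∫ φ ∂ₓω.
The steady equation reads p ∂ₓω = φ ∂_yω with p = y - c + ∂_yψ, whence φ ∂ₓω = φ² ∂_yω / p. For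
small ω, ∂_yp = 1 + ∂_y²ψ ≥ 1/2, so on each vertical line p has at most one zero Y, and |p| ≥ |y -
Y| / 2.

The point is that this singularity is always compensated (`slice_inequality`). At Y the equation
forces φ ∂_yω = 0. If φ(Y) = 0, Cauchy-Schwarz gives φ² ≤ |y - Y| ∫(∂_yφ)², which cancels the
denominator. If ∂_yω(Y) = 0, the Hölder bound |∂_yω| ≤ ε|y - Y|^α leaves |y - Y|^(α-1), which is
integrable for every α > 0. If p has no zero, a wall plays the role of Y, since φ vanishes there.
Hence ∫|φ ∂ₓω| ≤ Kε ∫|∂_yφ|² with K depending only on α. For small ε this is absorbed by the energy: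
φ = 0, so ψ and ω do not depend on x, and a square integrable function of y alone on the infinite
channel is zero.

The formal energy identity needs three justifications. Decay at infinity is not known, so a
horizontal cutoff of scale R is used; as φ is bounded, its error is O(1/R). Nothing is known about
∇φ at the walls, so a vertical cutoff is added; the bound |φ| ≤ ε(1 - y²)/2 makes its error vanish.
Finally φ is only C¹, so the identity is proved for horizontal difference quotients of ψ
(`energy_stream`). The pointwise bounds on ∂ₓψ and ∂ₓ²ψ come from the maximum principle with
quadratic barriers (`shift_sub_bounds`), without potential theory. -/

/-- The derivative of `f` in the direction `v`. -/
def dir (v : ℝ × ℝ) (f : ℝ × ℝ → ℝ) (z : ℝ × ℝ) : ℝ := fderiv ℝ f z v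

/-- The Laplacian. -/
def lap (f : ℝ × ℝ → ℝ) (z : ℝ × ℝ) : ℝ := dx (dx f) z + dy (dy f) z

/-! ### Directional derivatives and symmetries of the Laplacian -/

lemma dx_eq_dir (f : ℝ × ℝ → ℝ) : dx f = dir (1, 0) f := rfl

lemma dy_eq_dir (f : ℝ × ℝ → ℝ) : dy f = dir (0, 1) f := rfl

lemma isOpen_openChannel : IsOpen openChannel := isOpen_univ.prod isOpen_Ioo

lemma openChannel_subset_channel : openChannel ⊆ channel :=
  prod_mono_right Ioo_subset_Icc_self

lemma mem_openChannel {z : ℝ × ℝ} : z ∈ openChannel ↔ -1 < z.2 ∧ z.2 < 1 := by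
  simp [openChannel]

lemma mem_channel {z : ℝ × ℝ} : z ∈ channel ↔ -1 ≤ z.2 ∧ z.2 ≤ 1 := by
  simp [channel]

lemma contDiffOn_dir {m n : WithTop ℕ∞} {f : ℝ × ℝ → ℝ} {U : Set (ℝ × ℝ)} (v : ℝ × ℝ)
    (hf : ContDiffOn ℝ n f U) (hU : IsOpen U) (hmn : m + 1 ≤ n) :
    ContDiffOn ℝ m (dir v f) U :=
  (hf.fderiv_of_isOpen hU hmn).clm_apply contDiffOn_const

lemma dir_congr {f g : ℝ × ℝ → ℝ} {U : Set (ℝ × ℝ)} (hU : IsOpen U) (h : EqOn f g U)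
    (v : ℝ × ℝ) : EqOn (dir v f) (dir v g) U := by
  intro z hz
  have : f =ᶠ[𝓝 z] g := by filter_upwards [hU.mem_nhds hz] with x hx using h hx
  simp only [dir, this.fderiv_eq]

lemma dir_add {f g : ℝ × ℝ → ℝ} {z : ℝ × ℝ} (v : ℝ × ℝ) (hf : DifferentiableAt ℝ f z)
    (hg : DifferentiableAt ℝ g z) :
    dir v (fun x => f x + g x) z = dir v f z + dir v g z := by
  simp only [dir, fderiv_fun_add hf hg, _root_.add_apply]

lemma dir_neg (f : ℝ × ℝ → ℝ) (v : ℝ × ℝ) : dir v (fun x => -f x) = fun x => -dir v f x := by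
  funext z
  simp [dir, fderiv_fun_neg]

lemma dir_const_mul (c : ℝ) (f : ℝ × ℝ → ℝ) (v : ℝ × ℝ) :
    dir v (fun x => c * f x) = fun x => c * dir v f x := by
  funext z
  have : (fun x => c * f x) = c • f := rfl
  simp [dir, this, fderiv_const_smul_field]

lemma dir_mul {f g : ℝ × ℝ → ℝ} {z : ℝ × ℝ} (v : ℝ × ℝ) (hf : DifferentiableAt ℝ f z)
    (hg : DifferentiableAt ℝ g z) :
    dir v (fun x => f x * g x) z = f z * dir v g z + dir v f z * g z := by
  simp only [dir, fderiv_fun_mul hf hg, _root_.add_apply,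
    _root_.smul_apply, smul_eq_mul]
  ring

lemma dir_shift (f : ℝ × ℝ → ℝ) (a v : ℝ × ℝ) :
    dir v (fun x => f (x + a)) = fun x => dir v f (x + a) := by
  funext z
  simp [dir, fderiv_comp_add_right]

lemma dir_dir_add {f g : ℝ × ℝ → ℝ} {U : Set (ℝ × ℝ)} (hU : IsOpen U) (v : ℝ × ℝ)
    (hf : ContDiffOn ℝ 2 f U) (hg : ContDiffOn ℝ 2 g U) {z : ℝ × ℝ} (hz : z ∈ U) :
    dir v (dir v (fun x => f x + g x)) z = dir v (dir v f) z + dir v (dir v g) z := by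
  have h1 : EqOn (dir v (fun x => f x + g x)) (fun x => dir v f x + dir v g x) U := fun x hx =>
    dir_add v ((hf.differentiableOn (by norm_num)).differentiableAt (hU.mem_nhds hx))
      ((hg.differentiableOn (by norm_num)).differentiableAt (hU.mem_nhds hx))
  rw [dir_congr hU h1 v hz]
  have hf' : ContDiffOn ℝ 1 (dir v f) U := contDiffOn_dir v hf hU (by norm_num)
  have hg' : ContDiffOn ℝ 1 (dir v g) U := contDiffOn_dir v hg hU (by norm_num)
  exact dir_add v ((hf'.differentiableOn (by norm_num)).differentiableAt (hU.mem_nhds hz))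
    ((hg'.differentiableOn (by norm_num)).differentiableAt (hU.mem_nhds hz))

lemma lap_add {f g : ℝ × ℝ → ℝ} {U : Set (ℝ × ℝ)} (hU : IsOpen U)
    (hf : ContDiffOn ℝ 2 f U) (hg : ContDiffOn ℝ 2 g U) {z : ℝ × ℝ} (hz : z ∈ U) :
    lap (fun x => f x + g x) z = lap f z + lap g z := by
  simp only [lap, dx_eq_dir, dy_eq_dir, dir_dir_add hU _ hf hg hz]
  ring

lemma lap_neg (f : ℝ × ℝ → ℝ) (z : ℝ × ℝ) : lap (fun x => -f x) z = -lap f z := by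
  simp only [lap, dx_eq_dir, dy_eq_dir, dir_neg]
  ring

lemma lap_sub {f g : ℝ × ℝ → ℝ} {U : Set (ℝ × ℝ)} (hU : IsOpen U)
    (hf : ContDiffOn ℝ 2 f U) (hg : ContDiffOn ℝ 2 g U) {z : ℝ × ℝ} (hz : z ∈ U) :
    lap (fun x => f x - g x) z = lap f z - lap g z := by
  simp only [sub_eq_add_neg]
  rw [lap_add hU hf hg.neg hz, lap_neg]

lemma lap_shift (f : ℝ × ℝ → ℝ) (a z : ℝ × ℝ) :
    lap (fun x => f (x + a)) z = lap f (z + a) := by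
  simp only [lap, dx_eq_dir, dy_eq_dir, dir_shift]

/-- The reflection of the plane in the vertical axis. -/
def reflection : (ℝ × ℝ) ≃L[ℝ] (ℝ × ℝ) :=
  (ContinuousLinearEquiv.neg ℝ).prodCongr (ContinuousLinearEquiv.refl ℝ ℝ)

lemma reflection_apply (z : ℝ × ℝ) : reflection z = (-z.1, z.2) := rfl

lemma dir_reflection (f : ℝ × ℝ → ℝ) (v : ℝ × ℝ) :
    dir v (fun x => f (reflection x)) = fun x => dir (reflection v) f (reflection x) := by
  funext z
  have := reflection.comp_right_fderiv (f := f) (x := z)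
  simp only [dir]
  rw [show (fun x => f (reflection x)) = f ∘ reflection from rfl, this]
  rfl

lemma lap_reflection (f : ℝ × ℝ → ℝ) (z : ℝ × ℝ) :
    lap (fun x => f (reflection x)) z = lap f (reflection z) := by
  have h1 : reflection (1, 0) = -(1, 0) := by simp [reflection_apply]
  have h2 : reflection (0, 1) = (0, 1) := by simp [reflection_apply]
  have h3 : ∀ g, dir (-(1, 0)) g = fun x => -dir (1, 0) g x := by
    intro g; funext x; simp only [dir, map_neg]
  simp only [lap, dx_eq_dir, dy_eq_dir, dir_reflection, h1, h2, h3, dir_neg, neg_neg]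

/-! ### Maximum principle and barrier estimates -/

lemma hasDerivAt_line {f : ℝ × ℝ → ℝ} {z v : ℝ × ℝ} {t : ℝ}
    (hf : DifferentiableAt ℝ f (z + t • v)) :
    HasDerivAt (fun s : ℝ => f (z + s • v)) (dir v f (z + t • v)) t := by
  have h : HasDerivAt (fun s : ℝ => z + s • v) v t := by
    simpa using ((hasDerivAt_id t).smul_const v).const_add z
  exact hf.hasFDerivAt.comp_hasDerivAt t h

/-- At an interior maximum the second directional derivatives are nonpositive. -/
lemma dir_dir_nonpos_of_isLocalMax {w : ℝ × ℝ → ℝ} {U : Set (ℝ × ℝ)} (hU : IsOpen U)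
    (hw : ContDiffOn ℝ 2 w U) {z : ℝ × ℝ} (hz : z ∈ U) (hmax : IsLocalMax w z) (v : ℝ × ℝ) :
    dir v (dir v w) z ≤ 0 := by
  by_contra! hpos
  have hcl : Continuous (fun s : ℝ => z + s • v) := by fun_prop
  have hev : ∀ᶠ s in 𝓝 (0 : ℝ), z + s • v ∈ U := by
    apply hcl.continuousAt.eventually_mem
    simpa using hU.mem_nhds hz
  have hw1 : ContDiffOn ℝ 1 (dir v w) U := contDiffOn_dir v hw hU (by norm_num)
  set f : ℝ → ℝ := fun s => w (z + s • v) with hf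
  have hd : ∀ s, z + s • v ∈ U → HasDerivAt f (dir v w (z + s • v)) s := fun s hs =>
    hasDerivAt_line ((hw.differentiableOn (by norm_num)).differentiableAt (hU.mem_nhds hs))
  have hder : deriv f =ᶠ[𝓝 0] fun s => dir v w (z + s • v) := by
    filter_upwards [hev] with s hs using (hd s hs).deriv
  have hdd : deriv (deriv f) 0 = dir v (dir v w) z := by
    rw [hder.deriv_eq]
    have := hasDerivAt_line (f := dir v w) (z := z) (v := v) (t := 0)
      ((hw1.differentiableOn (by norm_num)).differentiableAt (hU.mem_nhds (by simpa using hz)))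
    simpa using this.deriv
  have hfmax : IsLocalMax f 0 := by
    have hc : Tendsto (fun s : ℝ => z + s • v) (𝓝 0) (𝓝 z) := by
      simpa using hcl.tendsto 0
    have := hc.eventually hmax
    filter_upwards [this] with s hs
    simpa [hf] using hs
  -- A positive second derivative would make the maximum also a minimum, hence `f` locally constant,
  -- with zero second derivative.
  have hfmin : IsLocalMin f 0 :=
    isLocalMin_of_deriv_deriv_pos (by rw [hdd]; exact hpos) hfmax.deriv_eq_zero
      (hd 0 (by simpa using hz)).continuousAt
  have hconst : f =ᶠ[𝓝 0] fun _ => f 0 := by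
    filter_upwards [hfmax, hfmin] with s h1 h2 using le_antisymm h1 h2
  have h0 : deriv f =ᶠ[𝓝 0] fun _ => 0 := by
    simpa using hconst.deriv
  rw [h0.deriv_eq] at hdd
  simp at hdd
  linarith

/-- The quadratic polynomials used as barriers. -/
def quad (a b p q : ℝ) (z : ℝ × ℝ) : ℝ := a + b * z.1 + p * z.1 ^ 2 + q * z.2 ^ 2

lemma contDiff_quad (a b p q : ℝ) : ContDiff ℝ 2 (quad a b p q) := by
  unfold quad
  fun_prop

lemma lap_quad (a b p q : ℝ) (z : ℝ × ℝ) : lap (quad a b p q) z = 2 * p + 2 * q := by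
  have hq : ∀ (v z : ℝ × ℝ), dir v (quad a b p q) z
      = b * v.1 + 2 * p * z.1 * v.1 + 2 * q * z.2 * v.2 := by
    intro v z
    have h1 : HasFDerivAt (fun z : ℝ × ℝ => z.1) (ContinuousLinearMap.fst ℝ ℝ ℝ) z :=
      hasFDerivAt_fst
    have h2 : HasFDerivAt (fun z : ℝ × ℝ => z.2) (ContinuousLinearMap.snd ℝ ℝ ℝ) z :=
      hasFDerivAt_snd
    have := (((h1.const_mul b).const_add a).add ((h1.pow 2).const_mul p)).add
      ((h2.pow 2).const_mul q)
    have h3 : fderiv ℝ (quad a b p q) z = _ := HasFDerivAt.fderiv this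
    rw [dir, h3]
    simp
    ring
  have hl : ∀ (r s t : ℝ) (v z : ℝ × ℝ),
      dir v (fun z : ℝ × ℝ => r + s * z.1 + t * z.2) z = s * v.1 + t * v.2 := by
    intro r s t v z
    have h1 : HasFDerivAt (fun z : ℝ × ℝ => z.1) (ContinuousLinearMap.fst ℝ ℝ ℝ) z :=
      hasFDerivAt_fst
    have h2 : HasFDerivAt (fun z : ℝ × ℝ => z.2) (ContinuousLinearMap.snd ℝ ℝ ℝ) z :=
      hasFDerivAt_snd
    have := ((h1.const_mul s).const_add r).add (h2.const_mul t)
    have h3 : fderiv ℝ (fun z : ℝ × ℝ => r + s * z.1 + t * z.2) z = _ := HasFDerivAt.fderiv this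
    rw [dir, h3]
    simp
  have e1 : dir (1, 0) (quad a b p q) = fun z : ℝ × ℝ => b + 2 * p * z.1 + 0 * z.2 := by
    funext z; rw [hq]; ring
  have e2 : dir (0, 1) (quad a b p q) = fun z : ℝ × ℝ => 0 + 0 * z.1 + 2 * q * z.2 := by
    funext z; rw [hq]; ring
  simp only [lap, dx_eq_dir, dy_eq_dir, e1, e2, hl]
  ring

/-- The weak maximum principle. -/
lemma nonpos_of_lap_nonneg {K U : Set (ℝ × ℝ)} (hK : IsCompact K) (hKc : K ⊆ channel)
    (hU : IsOpen U) (hUK : U ⊆ K) {w : ℝ × ℝ → ℝ} (hc : ContinuousOn w K)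
    (hw : ContDiffOn ℝ 2 w U) (hlap : ∀ z ∈ U, 0 ≤ lap w z) (hb : ∀ z ∈ K, z ∉ U → w z ≤ 0)
    {z : ℝ × ℝ} (hz : z ∈ K) : w z ≤ 0 := by
  by_contra! hpos
  set δ := w z / 2 with hδ
  have hδ0 : 0 < δ := by positivity
  -- Adding δ(y² - 1) makes the Laplacian strictly positive. The added term is nonpositive in the
  -- channel and lowers the value at `z` by at most δ, half of `w z`.
  set g : ℝ × ℝ → ℝ := fun x => w x + quad (-δ) 0 0 δ x with hg
  obtain ⟨m, hmK, hm⟩ := hK.exists_isMaxOn ⟨z, hz⟩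
    (hc.add (contDiff_quad (-δ) 0 0 δ).continuous.continuousOn : ContinuousOn g K)
  have hgm : 0 < g m := by
    have h1 : g z ≤ g m := hm hz
    have : g z = 2 * δ - δ + δ * z.2 ^ 2 := by simp only [hg, quad, hδ]; ring
    nlinarith [mul_nonneg hδ0.le (sq_nonneg z.2)]
  have hm2 : m.2 ^ 2 ≤ 1 := by
    obtain ⟨h1, h2⟩ := mem_channel.1 (hKc hmK)
    nlinarith
  have hmU : m ∈ U := by
    by_contra hnot
    have := hb m hmK hnot
    simp only [hg, quad] at hgm
    nlinarith
  have hloc : IsLocalMax g m := by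
    filter_upwards [hU.mem_nhds hmU] with x hx using hm (hUK hx)
  have hg2 : ContDiffOn ℝ 2 g U := hw.add (contDiff_quad (-δ) 0 0 δ).contDiffOn
  have h1 := dir_dir_nonpos_of_isLocalMax hU hg2 hmU hloc (1, 0)
  have h2 := dir_dir_nonpos_of_isLocalMax hU hg2 hmU hloc (0, 1)
  have h3 : lap g m = lap w m + (2 * 0 + 2 * δ) := by
    rw [hg, lap_add hU hw (contDiff_quad (-δ) 0 0 δ).contDiffOn hmU, lap_quad]
  have h4 := hlap m hmU
  simp only [lap, dx_eq_dir, dy_eq_dir] at h3 h4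
  linarith

/-- Comparison with `N (1 - y²) / 2` in the channel. -/
lemma le_of_neg_lap_le {u : ℝ × ℝ → ℝ} {N : ℝ} (hc : ContinuousOn u channel)
    (hu : ContDiffOn ℝ 2 u openChannel) (hbd : ∃ M : ℝ, ∀ z ∈ channel, |u z| ≤ M)
    (hbot : ∀ x : ℝ, u (x, -1) = 0) (htop : ∀ x : ℝ, u (x, 1) = 0)
    (hN : ∀ z ∈ openChannel, -lap u z ≤ N) {z : ℝ × ℝ} (hz : z ∈ channel) :
    u z ≤ N * (1 - z.2 ^ 2) / 2 := by
  obtain ⟨M, hM⟩ := hbd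
  -- The function x² + 1 - y² is harmonic, nonnegative in the channel and unbounded in x: it
  -- dominates the bounded `u` on distant vertical sides. Then δ tends to 0.
  have key : ∀ δ : ℝ, 0 < δ → u z ≤ N * (1 - z.2 ^ 2) / 2 + δ * (z.1 ^ 2 + 1 - z.2 ^ 2) := by
    intro δ hδ
    have hM0 : 0 ≤ M := (abs_nonneg _).trans (hM z hz)
    obtain ⟨R, hR1, hR2, hR3⟩ : ∃ R : ℝ, |z.1| ≤ R ∧ (M + |N|) / δ ≤ R ∧ 1 ≤ R :=
      ⟨max |z.1| (max ((M + |N|) / δ) 1), le_max_left _ _,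
        (le_max_left _ _).trans (le_max_right _ _), (le_max_right _ _).trans (le_max_right _ _)⟩
    have hRR : M + |N| ≤ δ * R ^ 2 := by
      rw [div_le_iff₀ hδ] at hR2
      nlinarith [mul_nonneg (mul_nonneg hδ.le (zero_le_one.trans hR3)) (sub_nonneg.2 hR3)]
    set q := quad (-N / 2 - δ) 0 (-δ) (N / 2 + δ) with hq
    have hq2 : ContDiff ℝ 2 q := contDiff_quad _ _ _ _
    have hUo : (Ioo (-R) R ×ˢ Ioo (-1 : ℝ) 1) ⊆ openChannel := prod_mono_left (subset_univ _)
    have hKc : (Icc (-R) R ×ˢ Icc (-1 : ℝ) 1) ⊆ channel := prod_mono_left (subset_univ _)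
    have hw := nonpos_of_lap_nonneg (K := Icc (-R) R ×ˢ Icc (-1) 1) (U := Ioo (-R) R ×ˢ Ioo (-1) 1)
      (w := fun x => u x + q x) (isCompact_Icc.prod isCompact_Icc) hKc
      (isOpen_Ioo.prod isOpen_Ioo) (prod_mono Ioo_subset_Icc_self Ioo_subset_Icc_self)
      ((hc.mono hKc).add hq2.continuous.continuousOn)
      ((hu.mono hUo).add hq2.contDiffOn)
      (by
        intro x hx
        rw [lap_add isOpen_openChannel hu hq2.contDiffOn (hUo hx), hq, lap_quad]
        linarith [hN x (hUo hx)])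
      (by
        rintro ⟨x, y⟩ hxK hxU
        simp only [mem_prod, mem_Icc, mem_Ioo, not_and_or, not_lt] at hxK hxU
        obtain ⟨⟨ha, hb⟩, hc1, hd⟩ := hxK
        have hy2 : y ^ 2 ≤ 1 := by nlinarith
        have hedge : y ^ 2 = 1 → u (x, y) = 0 → u (x, y) + q (x, y) ≤ 0 := by
          intro h1 h2
          simp only [hq, quad, h1, h2]
          nlinarith [mul_nonneg hδ.le (sq_nonneg x)]
        have hside : x ^ 2 = R ^ 2 → u (x, y) + q (x, y) ≤ 0 := by
          intro h1
          have h2 := (le_abs_self _).trans (hM (x, y) (hKc ⟨⟨ha, hb⟩, hc1, hd⟩))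
          have h3 : -N / 2 * (1 - y ^ 2) ≤ |N| := by
            nlinarith [neg_abs_le N, abs_nonneg N, mul_nonneg (abs_nonneg N) (sq_nonneg y),
              mul_nonneg (sub_nonneg.2 (neg_abs_le N)) (sub_nonneg.2 hy2)]
          simp only [hq, quad, h1]
          nlinarith [mul_nonneg hδ.le (sub_nonneg.2 hy2)]
        rcases hxU with (h | h) | (h | h)
        · exact hside (by rw [show x = -R by linarith]; ring)
        · exact hside (by rw [show x = R by linarith])
        · obtain rfl : y = -1 := by linarith
          exact hedge (by norm_num) (hbot x)
        · obtain rfl : y = 1 := by linarith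
          exact hedge (by norm_num) (htop x))
      (z := z) ⟨abs_le.1 hR1, mem_channel.1 hz⟩
    simp only [hq, quad] at hw
    linarith
  apply le_of_forall_pos_le_add
  intro e he
  have h2 : z.2 ^ 2 ≤ 1 := by
    obtain ⟨h1, h2⟩ := mem_channel.1 hz
    nlinarith
  have hp : 0 < z.1 ^ 2 + 2 := by positivity
  have := key (e / (z.1 ^ 2 + 2)) (by positivity)
  have h3 : e / (z.1 ^ 2 + 2) * (z.1 ^ 2 + 1 - z.2 ^ 2) ≤ e := by
    rw [div_mul_eq_mul_div, div_le_iff₀ hp]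
    nlinarith [sq_nonneg z.2]
  linarith

lemma abs_le_of_abs_lap_le {u : ℝ × ℝ → ℝ} {N : ℝ} (hc : ContinuousOn u channel)
    (hu : ContDiffOn ℝ 2 u openChannel) (hbd : ∃ M : ℝ, ∀ z ∈ channel, |u z| ≤ M)
    (hbot : ∀ x : ℝ, u (x, -1) = 0) (htop : ∀ x : ℝ, u (x, 1) = 0)
    (hN : ∀ z ∈ openChannel, |lap u z| ≤ N) {z : ℝ × ℝ} (hz : z ∈ channel) :
    |u z| ≤ N * (1 - z.2 ^ 2) / 2 := by
  refine abs_le'.2 ⟨le_of_neg_lap_le hc hu hbd hbot htop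
    (fun z hz => (neg_le_abs _).trans (hN z hz)) hz, ?_⟩
  refine le_of_neg_lap_le (u := fun z => -u z) hc.neg hu.neg (by simpa using hbd) (by simpa using hbot)
    (by simpa using htop) (fun z hz => ?_) hz
  rw [lap_neg, neg_neg]
  exact (le_abs_self _).trans (hN z hz)

lemma le_of_hasDerivAt_of_le {g : ℝ → ℝ} {g' C : ℝ} (hg : HasDerivAt g g' 0) (h0 : g 0 = 0)
    (hle : ∀ t ∈ Ioc (0 : ℝ) 1, g t ≤ C * t) : g' ≤ C := by
  have h1 := hg.tendsto_slope_zero_right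
  refine le_of_tendsto h1 ?_
  filter_upwards [Ioc_mem_nhdsGT (zero_lt_one' ℝ)] with t ht
  simp only [zero_add, h0, sub_zero, smul_eq_mul]
  rw [inv_mul_le_iff₀ ht.1, mul_comm]
  exact hle t ht

/-- The tangential derivative of a solution of a Poisson problem with bounded right-hand side:
the difference of the solution and its mirror image is compared with `2 N (x - x² / 2)`. -/
lemma dx_le_of_abs_lap_le {u : ℝ × ℝ → ℝ} {N : ℝ} (hc : ContinuousOn u channel)
    (hu : ContDiffOn ℝ 2 u openChannel) (hbd : ∃ M : ℝ, ∀ z ∈ channel, |u z| ≤ M)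
    (hbot : ∀ x : ℝ, u (x, -1) = 0) (htop : ∀ x : ℝ, u (x, 1) = 0)
    (hN : ∀ z ∈ openChannel, |lap u z| ≤ N) {z : ℝ × ℝ} (hz : z ∈ openChannel) :
    dx u z ≤ N := by
  obtain ⟨x₀, y₀⟩ := z
  have hN0 : 0 ≤ N := (abs_nonneg _).trans (hN _ hz)
  have hcomp := fun {z} => abs_le_of_abs_lap_le hc hu hbd hbot htop hN (z := z)
  set a : ℝ × ℝ := (x₀, 0) with ha
  set u₁ : ℝ × ℝ → ℝ := fun x => u (x + a) with hu₁
  set u₂ : ℝ × ℝ → ℝ := fun x => u₁ (reflection x) with hu₂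
  have hshift : MapsTo (fun x => x + a) channel channel := by
    intro x hx; simpa [mem_channel, ha] using hx
  have hshift' : MapsTo (fun x => x + a) openChannel openChannel := by
    intro x hx; simpa [mem_openChannel, ha] using hx
  have hrefl : MapsTo reflection channel channel := by
    intro x hx; simpa [mem_channel, reflection_apply] using hx
  have hrefl' : MapsTo reflection openChannel openChannel := by
    intro x hx; simpa [mem_openChannel, reflection_apply] using hx
  have hc₁ : ContinuousOn u₁ channel := hc.comp (by fun_prop) hshift
  have hc₂ : ContinuousOn u₂ channel := hc₁.comp reflection.continuous.continuousOn hrefl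
  have hs₁ : ContDiffOn ℝ 2 u₁ openChannel :=
    hu.comp (contDiff_id.add contDiff_const).contDiffOn hshift'
  have hs₂ : ContDiffOn ℝ 2 u₂ openChannel := hs₁.comp reflection.contDiff.contDiffOn hrefl'
  -- The difference `u₁ - u₂` vanishes at x = 0 and on the walls, its Laplacian is at most 2N in
  -- size, and at x = 1 it is at most N(1 - y²) ≤ N by the previous barrier. This `q` has Laplacian
  -- 2N, is nonpositive on [0, 1] and equals -N at x = 1.
  set q := quad 0 (-(2 * N)) N 0 with hq
  have hq2 : ContDiff ℝ 2 q := contDiff_quad _ _ _ _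
  have hUo : (Ioo 0 1 ×ˢ Ioo (-1 : ℝ) 1) ⊆ openChannel := prod_mono_left (subset_univ _)
  have hKc : (Icc 0 1 ×ˢ Icc (-1 : ℝ) 1) ⊆ channel := prod_mono_left (subset_univ _)
  have hmax : ∀ x ∈ Icc (0 : ℝ) 1 ×ˢ Icc (-1 : ℝ) 1, u₁ x - u₂ x + q x ≤ 0 := by
    intro x hx
    refine nonpos_of_lap_nonneg (K := Icc 0 1 ×ˢ Icc (-1) 1) (U := Ioo 0 1 ×ˢ Ioo (-1) 1)
      (w := fun x => (u₁ x - u₂ x) + q x) (isCompact_Icc.prod isCompact_Icc) hKc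
      (isOpen_Ioo.prod isOpen_Ioo) (prod_mono Ioo_subset_Icc_self Ioo_subset_Icc_self)
      (((hc₁.sub hc₂).mono hKc).add hq2.continuous.continuousOn)
      (((hs₁.sub hs₂).mono hUo).add hq2.contDiffOn) ?_ ?_ hx
    · intro x hx
      have hxo := hUo hx
      rw [lap_add isOpen_openChannel (hs₁.sub hs₂) hq2.contDiffOn hxo, hq, lap_quad,
        lap_sub isOpen_openChannel hs₁ hs₂ hxo, hu₂, lap_reflection, hu₁, lap_shift, lap_shift]
      have h1 := (abs_le.1 (hN _ (hshift' hxo))).1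
      have h2 := (abs_le.1 (hN _ (hshift' (hrefl' hxo)))).2
      simp only at h1 h2
      linarith
    · rintro ⟨x, y⟩ hxK hxU
      have hxc := hKc hxK
      simp only [mem_prod, mem_Icc, mem_Ioo, not_and_or, not_lt] at hxK hxU
      obtain ⟨⟨hx0, hx1⟩, hy0, hy1⟩ := hxK
      have hqn : q (x, y) ≤ 0 := by
        simp only [hq, quad]
        nlinarith [mul_nonneg hN0 hx0]
      have hu1v : u₁ (x, y) = u (x + x₀, y) := by simp [hu₁, ha]
      have hu2v : u₂ (x, y) = u (-x + x₀, y) := by simp [hu₂, hu₁, ha, reflection_apply]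
      simp only [hu1v, hu2v]
      rcases hxU with (h | h) | (h | h)
      · obtain rfl : x = 0 := by linarith
        simpa using hqn
      · obtain rfl : x = 1 := by linarith
        have h1 := (abs_le.1 (hcomp (z := (1 + x₀, y)) (by simpa [mem_channel] using hxc))).2
        have h2 := (abs_le.1 (hcomp (z := (-1 + x₀, y)) (by simpa [mem_channel] using hxc))).1
        simp only [hq, quad] at h1 h2 ⊢
        nlinarith [mul_nonneg hN0 (sq_nonneg y)]
      · obtain rfl : y = -1 := by linarith
        simpa [hbot] using hqn
      · obtain rfl : y = 1 := by linarith
        simpa [htop] using hqn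
  have hda : DifferentiableAt ℝ u (x₀, y₀) :=
    (hu.differentiableOn (by norm_num)).differentiableAt (isOpen_openChannel.mem_nhds hz)
  have hline : HasDerivAt (fun s : ℝ => u ((x₀, y₀) + s • ((1 : ℝ), (0 : ℝ)))) (dx u (x₀, y₀)) 0 := by
    have := hasDerivAt_line (f := u) (z := (x₀, y₀)) (v := (1, 0)) (t := 0) (by simpa using hda)
    rw [zero_smul, add_zero] at this
    exact this
  have hline' : HasDerivAt (fun s : ℝ => u ((x₀, y₀) + (-s) • ((1 : ℝ), (0 : ℝ))))
      (-dx u (x₀, y₀)) 0 := by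
    have h := hline
    rw [← neg_zero] at h
    simpa [Function.comp_def] using h.scomp (0 : ℝ) (hasDerivAt_neg (0 : ℝ))
  -- The difference with the mirror image has slope 2 ∂ₓu on the axis, so the factor 2 cancels.
  have := le_of_hasDerivAt_of_le (C := 2 * N) (hline.sub hline') (by simp) (by
    intro t ht
    have h1 := hmax (t, y₀) ⟨⟨ht.1.le, ht.2⟩, mem_channel.1 (openChannel_subset_channel hz)⟩
    have hu1v : u₁ (t, y₀) = u (x₀ + t, y₀) := by simp [hu₁, ha, add_comm]
    have hu2v : u₂ (t, y₀) = u (x₀ + -t, y₀) := by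
      simp [hu₂, hu₁, ha, reflection_apply, add_comm]
    simp only [hu1v, hu2v, hq, quad] at h1
    simp only [Pi.sub_apply, Prod.smul_mk, Prod.mk_add_mk, smul_eq_mul, mul_one, mul_zero, add_zero]
    nlinarith [mul_nonneg hN0 (sq_nonneg t)])
  linarith

lemma abs_dx_le_of_abs_lap_le {u : ℝ × ℝ → ℝ} {N : ℝ} (hc : ContinuousOn u channel)
    (hu : ContDiffOn ℝ 2 u openChannel) (hbd : ∃ M : ℝ, ∀ z ∈ channel, |u z| ≤ M)
    (hbot : ∀ x : ℝ, u (x, -1) = 0) (htop : ∀ x : ℝ, u (x, 1) = 0)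
    (hN : ∀ z ∈ openChannel, |lap u z| ≤ N) {z : ℝ × ℝ} (hz : z ∈ openChannel) :
    |dx u z| ≤ N := by
  refine abs_le'.2 ⟨dx_le_of_abs_lap_le hc hu hbd hbot htop hN hz, ?_⟩
  have := dx_le_of_abs_lap_le (u := fun z => -u z) (N := N) hc.neg hu.neg (by simpa using hbd)
    (by simpa using hbot) (by simpa using htop) (fun z hz => by
      rw [lap_neg, abs_neg]; exact hN z hz) hz
  rwa [dx_eq_dir, dir_neg] at this

/-! ### Horizontal increments and pointwise bounds for the stream function -/

lemma shift_mem_channel {z : ℝ × ℝ} (h : ℝ) (hz : z ∈ channel) : z + (h, 0) ∈ channel := by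
  simpa [mem_channel] using hz

lemma shift_mem_openChannel {z : ℝ × ℝ} (h : ℝ) (hz : z ∈ openChannel) :
    z + (h, 0) ∈ openChannel := by
  simpa [mem_openChannel] using hz

lemma hasDerivAt_horizontal {f : ℝ × ℝ → ℝ} (hf : ContDiffOn ℝ 1 f openChannel) {z : ℝ × ℝ}
    (hz : z ∈ openChannel) (t : ℝ) :
    HasDerivAt (fun s : ℝ => f (z + (s, 0))) (dx f (z + (t, 0))) t := by
  have := hasDerivAt_line (f := f) (z := z) (v := (1, 0)) (t := t)
    ((hf.differentiableOn (by norm_num)).differentiableAt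
      (isOpen_openChannel.mem_nhds (by simpa using shift_mem_openChannel t hz)))
  simpa [dx_eq_dir] using this

lemma abs_shift_sub_le {f : ℝ × ℝ → ℝ} {C h : ℝ} (hf : ContDiffOn ℝ 1 f openChannel) {z : ℝ × ℝ}
    (hz : z ∈ openChannel) (hh : 0 ≤ h) (hC : ∀ s ∈ Icc 0 h, |dx f (z + (s, 0))| ≤ C) :
    |f (z + (h, 0)) - f z| ≤ C * h := by
  have := norm_image_sub_le_of_norm_deriv_le_segment' (f := fun s : ℝ => f (z + (s, 0)))
    (f' := fun s => dx f (z + (s, 0))) (a := 0) (b := h) (C := C)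
    (fun s _ => (hasDerivAt_horizontal hf hz s).hasDerivWithinAt)
    (fun s hs => hC s (Ico_subset_Icc_self hs)) h ⟨hh, le_rfl⟩
  have e : z + ((0 : ℝ), (0 : ℝ)) = z := add_zero z
  simpa [e] using this

lemma abs_deriv_le_of_abs_sub_le {g : ℝ → ℝ} {g' C : ℝ} (hg : HasDerivAt g g' 0)
    (hle : ∀ t ∈ Ioc (0 : ℝ) 1, |g t - g 0| ≤ C * t) : |g'| ≤ C := by
  refine abs_le'.2 ⟨?_, ?_⟩
  · exact le_of_hasDerivAt_of_le (hg.sub_const (g 0)) (by simp)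
      fun t ht => (le_abs_self _).trans (hle t ht)
  · refine le_of_hasDerivAt_of_le (hg.sub_const (g 0)).neg (by simp)
      fun t ht => ?_
    exact (neg_le_abs _).trans (hle t ht)

lemma abs_dx_le_of_abs_shift_le {f : ℝ × ℝ → ℝ} {C : ℝ} (hf : ContDiffOn ℝ 1 f openChannel)
    {z : ℝ × ℝ} (hz : z ∈ openChannel)
    (hle : ∀ t ∈ Ioc (0 : ℝ) 1, |f (z + (t, 0)) - f z| ≤ C * t) : |dx f z| ≤ C := by
  have e : z + ((0 : ℝ), (0 : ℝ)) = z := add_zero z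
  have := hasDerivAt_horizontal hf hz 0
  rw [e] at this
  exact abs_deriv_le_of_abs_sub_le this (by simpa [e] using hle)

section Stream

variable {ω ψ : ℝ × ℝ → ℝ} {ε : ℝ}

lemma lap_shift_sub (hψ : IsStreamFunction ω ψ) (h : ℝ) {z : ℝ × ℝ} (hz : z ∈ openChannel) :
    lap (fun x => ψ (x + (h, 0)) - ψ x) z = -(ω (z + (h, 0)) - ω z) := by
  have hs : ContDiffOn ℝ 2 (fun x => ψ (x + (h, 0))) openChannel :=
    hψ.contDiffOn.comp (contDiff_id.add contDiff_const).contDiffOn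
      fun x hx => shift_mem_openChannel h hx
  rw [lap_sub isOpen_openChannel hs hψ.contDiffOn hz, lap_shift]
  have h1 := hψ.poisson _ hz
  have h2 := hψ.poisson _ (shift_mem_openChannel h hz)
  simp only [lap]
  linarith

/-- A horizontal increment of ψ solves a Dirichlet problem whose right-hand side is the increment of
ω, of size at most εh, so both barrier estimates apply. Dividing by h bounds ∂ₓψ and ∂ₓ²ψ without
assuming that ψ has derivatives at the walls. -/
lemma shift_sub_bounds (hψ : IsStreamFunction ω ψ) (hω : ContDiffOn ℝ 1 ω openChannel)
    (hdx : ∀ z ∈ openChannel, |dx ω z| ≤ ε) {h : ℝ} (hh : 0 ≤ h) {z : ℝ × ℝ}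
    (hz : z ∈ openChannel) :
    |ψ (z + (h, 0)) - ψ z| ≤ ε * h * (1 - z.2 ^ 2) / 2 ∧
      |dx ψ (z + (h, 0)) - dx ψ z| ≤ ε * h := by
  have hs : ContDiffOn ℝ 2 (fun x => ψ (x + (h, 0))) openChannel :=
    hψ.contDiffOn.comp (contDiff_id.add contDiff_const).contDiffOn
      fun x hx => shift_mem_openChannel h hx
  have hc : ContinuousOn (fun x => ψ (x + (h, 0)) - ψ x) channel :=
    (hψ.continuousOn.comp (by fun_prop) fun x hx => shift_mem_channel h hx).sub hψ.continuousOn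
  have hbd : ∃ M : ℝ, ∀ z ∈ channel, |ψ (z + (h, 0)) - ψ z| ≤ M := by
    obtain ⟨M, hM⟩ := hψ.bounded
    exact ⟨M + M, fun z hz => (abs_sub _ _).trans
      (add_le_add (hM _ (shift_mem_channel h hz)) (hM z hz))⟩
  have hN : ∀ z ∈ openChannel, |lap (fun x => ψ (x + (h, 0)) - ψ x) z| ≤ ε * h := by
    intro z hz
    rw [lap_shift_sub hψ h hz, abs_neg]
    exact abs_shift_sub_le hω hz hh fun s _ => hdx _ (shift_mem_openChannel s hz)
  refine ⟨abs_le_of_abs_lap_le hc (hs.sub hψ.contDiffOn) hbd (by simp [hψ.bottom])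
    (by simp [hψ.top]) hN (openChannel_subset_channel hz), ?_⟩
  have := abs_dx_le_of_abs_lap_le hc (hs.sub hψ.contDiffOn) hbd (by simp [hψ.bottom])
    (by simp [hψ.top]) hN hz
  simp only [sub_eq_add_neg] at this
  rwa [dx_eq_dir, dir_add, dir_shift, dir_neg] at this
  · exact (hs.differentiableOn (by norm_num)).differentiableAt (isOpen_openChannel.mem_nhds hz)
  · exact ((hψ.contDiffOn.differentiableOn (by norm_num)).differentiableAt
      (isOpen_openChannel.mem_nhds hz)).neg

lemma contDiffOn_dx_stream (hψ : IsStreamFunction ω ψ) : ContDiffOn ℝ 1 (dx ψ) openChannel :=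
  contDiffOn_dir (1, 0) hψ.contDiffOn isOpen_openChannel (by norm_num)

lemma contDiffOn_dy_stream (hψ : IsStreamFunction ω ψ) : ContDiffOn ℝ 1 (dy ψ) openChannel :=
  contDiffOn_dir (0, 1) hψ.contDiffOn isOpen_openChannel (by norm_num)

lemma abs_dx_stream_le (hψ : IsStreamFunction ω ψ) (hω : ContDiffOn ℝ 1 ω openChannel)
    (hdx : ∀ z ∈ openChannel, |dx ω z| ≤ ε) {z : ℝ × ℝ} (hz : z ∈ openChannel) :
    |dx ψ z| ≤ ε * (1 - z.2 ^ 2) / 2 :=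
  abs_dx_le_of_abs_shift_le (hψ.contDiffOn.of_le (by norm_num)) hz fun _ ht => by
    linarith [(shift_sub_bounds hψ hω hdx ht.1.le hz).1]

lemma abs_dx_dx_stream_le (hψ : IsStreamFunction ω ψ) (hω : ContDiffOn ℝ 1 ω openChannel)
    (hdx : ∀ z ∈ openChannel, |dx ω z| ≤ ε) {z : ℝ × ℝ} (hz : z ∈ openChannel) :
    |dx (dx ψ) z| ≤ ε :=
  abs_dx_le_of_abs_shift_le (contDiffOn_dx_stream hψ) hz fun _ ht =>
    (shift_sub_bounds hψ hω hdx ht.1.le hz).2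

/-- The Poisson equation gives ∂_y²ψ = -ω - ∂ₓ²ψ, and both terms are already bounded. This is what
makes y - c + ∂_yψ strictly increasing in y. -/
lemma abs_dy_dy_stream_le (hψ : IsStreamFunction ω ψ) (hω : ContDiffOn ℝ 1 ω openChannel)
    (hsup : ∀ z ∈ openChannel, |ω z| ≤ ε) (hdx : ∀ z ∈ openChannel, |dx ω z| ≤ ε) {z : ℝ × ℝ}
    (hz : z ∈ openChannel) : |dy (dy ψ) z| ≤ 2 * ε := by
  have h1 := abs_le.1 (abs_dx_dx_stream_le hψ hω hdx hz)
  have h2 := abs_le.1 (hsup z hz)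
  have h3 := hψ.poisson z hz
  exact abs_le.2 ⟨by linarith, by linarith⟩

lemma dy_dx_stream (hψ : IsStreamFunction ω ψ) {z : ℝ × ℝ} (hz : z ∈ openChannel) :
    dx (dy ψ) z = dy (dx ψ) z := by
  have hat : ContDiffAt ℝ 2 ψ z := hψ.contDiffOn.contDiffAt (isOpen_openChannel.mem_nhds hz)
  have hsymm : IsSymmSndFDerivAt ℝ ψ z := hat.isSymmSndFDerivAt (by simp)
  have hd : DifferentiableAt ℝ (fderiv ℝ ψ) z :=
    (hat.fderiv_right (m := 1) (by norm_num)).differentiableAt (by norm_num)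
  have key : ∀ v w : ℝ × ℝ, dir v (dir w ψ) z = fderiv ℝ (fderiv ℝ ψ) z v w := by
    intro v w
    have : HasFDerivAt (fun x => fderiv ℝ ψ x w) _ z :=
      hd.hasFDerivAt.clm_apply (hasFDerivAt_const w z)
    unfold dir
    rw [this.fderiv]
    simp
  rw [dx_eq_dir, dy_eq_dir, dx_eq_dir, dy_eq_dir, key, key]
  exact hsymm _ _

end Stream

/-! ### The localized energy identity -/

lemma lap_const_mul (c : ℝ) (f : ℝ × ℝ → ℝ) (z : ℝ × ℝ) :
    lap (fun x => c * f x) z = c * lap f z := by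
  simp only [lap, dx_eq_dir, dy_eq_dir, dir_const_mul]
  ring

lemma integral_dir_eq_zero {X : ℝ × ℝ → ℝ} (hX : ContDiff ℝ 1 X) (hs : HasCompactSupport X)
    (v : ℝ × ℝ) : Integrable (dir v X) ∧ ∫ z, dir v X z = 0 := by
  have hcont : Continuous (dir v X) :=
    (hX.continuous_fderiv (by norm_num)).clm_apply continuous_const
  have hint : Integrable (dir v X) :=
    hcont.integrable_of_hasCompactSupport (hs.fderiv_apply (𝕜 := ℝ) v)
  refine ⟨hint, ?_⟩
  have := integral_mul_fderiv_eq_neg_fderiv_mul_of_integrable (μ := volume) (𝕜 := ℝ) (v := v)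
    (f := fun _ : ℝ × ℝ => (1 : ℝ)) (g := X) (by simp)
    (by simp only [one_mul]; exact hint)
    (by simpa using hX.continuous.integrable_of_hasCompactSupport hs)
    (fun _ _ => by fun_prop) (fun _ _ => hX.differentiable (by norm_num) _)
  simpa [dir] using this

lemma dir_eq_zero_of_notMem_tsupport {f : ℝ × ℝ → ℝ} {z : ℝ × ℝ} (v : ℝ × ℝ)
    (hz : z ∉ tsupport f) : dir v f z = 0 := by
  have : f =ᶠ[𝓝 z] fun _ => 0 := notMem_tsupport_iff_eventuallyEq.1 hz
  simp [dir, this.fderiv_eq]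

lemma tsupport_dir_subset (f : ℝ × ℝ → ℝ) (v : ℝ × ℝ) : tsupport (dir v f) ⊆ tsupport f :=
  closure_minimal (fun z hz => by
    by_contra hn
    exact hz (dir_eq_zero_of_notMem_tsupport v hn)) (isClosed_tsupport f)

/-- Green's identity for u² and the test function G: the integrand is the derivative along v of the
compactly supported function G ∂_v(u²) - u² ∂_vG. -/
lemma energy_dir {U : Set (ℝ × ℝ)} (hU : IsOpen U) {u G : ℝ × ℝ → ℝ} (hu : ContDiffOn ℝ 2 u U)
    (hG : ContDiff ℝ 2 G) (hGc : HasCompactSupport G) (hGU : tsupport G ⊆ U) (v : ℝ × ℝ) :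
    Integrable (fun z => G z * (2 * dir v u z ^ 2 + 2 * u z * dir v (dir v u) z)
      - u z ^ 2 * dir v (dir v G) z) ∧
    ∫ z, (G z * (2 * dir v u z ^ 2 + 2 * u z * dir v (dir v u) z)
      - u z ^ 2 * dir v (dir v G) z) = 0 := by
  set X : ℝ × ℝ → ℝ := fun z => G z * (2 * u z * dir v u z) + -(u z * u z * dir v G z) with hX
  have hu1 : ContDiffOn ℝ 1 (dir v u) U := contDiffOn_dir v hu hU (by norm_num)
  have hG1 : ContDiff ℝ 1 (dir v G) := by
    rw [← contDiffOn_univ] at hG ⊢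
    exact contDiffOn_dir v hG isOpen_univ (by norm_num)
  have hu1' : ContDiffOn ℝ 1 u U := hu.of_le (by norm_num)
  have hG1' : ContDiff ℝ 1 G := hG.of_le (by norm_num)
  have hzero : ∀ z, z ∉ tsupport G → X z = 0 := fun z hz => by
    simp [hX, image_eq_zero_of_notMem_tsupport hz, dir_eq_zero_of_notMem_tsupport v hz]
  have hXs : tsupport X ⊆ tsupport G := closure_minimal (fun z hz => by
    by_contra hn
    exact hz (hzero z hn)) (isClosed_tsupport G)
  have hXU : ContDiffOn ℝ 1 X U :=
    (hG1'.contDiffOn.mul ((contDiffOn_const.mul hu1').mul hu1)).add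
      ((hu1'.mul hu1').mul hG1.contDiffOn).neg
  have hX1 : ContDiff ℝ 1 X :=
    contDiff_iff_contDiffAt.2 fun z => by
      by_cases hz : z ∈ tsupport X
      · exact hXU.contDiffAt (hU.mem_nhds (hGU (hXs hz)))
      · exact contDiffAt_const.congr_of_eventuallyEq (notMem_tsupport_iff_eventuallyEq.1 hz)
  have hXc : HasCompactSupport X := hGc.of_isClosed_subset (isClosed_tsupport X) hXs
  have hdir : dir v X = fun z => G z * (2 * dir v u z ^ 2 + 2 * u z * dir v (dir v u) z)
      - u z ^ 2 * dir v (dir v G) z := by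
    funext z
    by_cases hz : z ∈ U
    · have du : DifferentiableAt ℝ u z :=
        (hu1'.differentiableOn (by norm_num)).differentiableAt (hU.mem_nhds hz)
      have ddu : DifferentiableAt ℝ (dir v u) z :=
        (hu1.differentiableOn (by norm_num)).differentiableAt (hU.mem_nhds hz)
      have dG : DifferentiableAt ℝ G z := hG1'.differentiable (by norm_num) z
      have ddG : DifferentiableAt ℝ (dir v G) z := hG1.differentiable (by norm_num) z
      have d1 : DifferentiableAt ℝ (fun x => 2 * u x) z := by fun_prop
      have d2 : DifferentiableAt ℝ (fun x => 2 * u x * dir v u x) z := by fun_prop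
      have d3 : DifferentiableAt ℝ (fun x => G x * (2 * u x * dir v u x)) z := by fun_prop
      have d4 : DifferentiableAt ℝ (fun x => u x * u x) z := by fun_prop
      have d5 : DifferentiableAt ℝ (fun x => -(u x * u x * dir v G x)) z := by fun_prop
      rw [hX, dir_add v d3 d5, dir_mul v dG d2, dir_mul v d1 ddu, dir_neg]
      simp only
      rw [dir_mul v d4 ddG, dir_mul v du du, dir_const_mul]
      ring
    · have hzG : z ∉ tsupport G := fun h => hz (hGU h)
      rw [dir_eq_zero_of_notMem_tsupport v fun h => hzG (hXs h),
        image_eq_zero_of_notMem_tsupport hzG,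
        dir_eq_zero_of_notMem_tsupport v fun h => hzG (tsupport_dir_subset G v h)]
      ring
  rw [← hdir]
  exact integral_dir_eq_zero hX1 hXc v

lemma energy_lap {U : Set (ℝ × ℝ)} (hU : IsOpen U) {u G : ℝ × ℝ → ℝ} (hu : ContDiffOn ℝ 2 u U)
    (hG : ContDiff ℝ 2 G) (hGc : HasCompactSupport G) (hGU : tsupport G ⊆ U) :
    Integrable (fun z => G z * (2 * dx u z ^ 2 + 2 * dy u z ^ 2 + 2 * u z * lap u z)
      - u z ^ 2 * lap G z) ∧
    ∫ z, (G z * (2 * dx u z ^ 2 + 2 * dy u z ^ 2 + 2 * u z * lap u z)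
      - u z ^ 2 * lap G z) = 0 := by
  obtain ⟨h1, h2⟩ := energy_dir hU hu hG hGc hGU (1, 0)
  obtain ⟨h3, h4⟩ := energy_dir hU hu hG hGc hGU (0, 1)
  have e : (fun z => G z * (2 * dx u z ^ 2 + 2 * dy u z ^ 2 + 2 * u z * lap u z)
      - u z ^ 2 * lap G z) = fun z =>
      (G z * (2 * dir (1, 0) u z ^ 2 + 2 * u z * dir (1, 0) (dir (1, 0) u) z)
        - u z ^ 2 * dir (1, 0) (dir (1, 0) G) z) +
      (G z * (2 * dir (0, 1) u z ^ 2 + 2 * u z * dir (0, 1) (dir (0, 1) u) z)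
        - u z ^ 2 * dir (0, 1) (dir (0, 1) G) z) := by
    funext z
    simp only [lap, dx_eq_dir, dy_eq_dir]
    ring
  rw [e]
  exact ⟨h1.add h3, by rw [integral_add h1 h3, h2, h4, add_zero]⟩

lemma continuousOn_dir {f : ℝ × ℝ → ℝ} (hf : ContDiffOn ℝ 1 f openChannel) (v : ℝ × ℝ) :
    ContinuousOn (dir v f) openChannel :=
  (contDiffOn_dir (m := 0) v hf isOpen_openChannel (by norm_num)).continuousOn

/-- The horizontal difference quotient. -/
def quot (h : ℝ) (f : ℝ × ℝ → ℝ) (z : ℝ × ℝ) : ℝ := h⁻¹ * (f (z + (h, 0)) - f z)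

lemma tendsto_quot {f : ℝ × ℝ → ℝ} (hf : ContDiffOn ℝ 1 f openChannel) {z : ℝ × ℝ}
    (hz : z ∈ openChannel) : Tendsto (fun h => quot h f z) (𝓝[>] 0) (𝓝 (dx f z)) := by
  have e : z + ((0 : ℝ), (0 : ℝ)) = z := add_zero z
  have := hasDerivAt_horizontal hf hz 0
  rw [e] at this
  simpa [quot, e] using this.tendsto_slope_zero_right

/-- Horizontal shifts of length at most 1 sweep K over a compact subset of the open channel, where
∂ₓf is bounded. This supplies the domination when h tends to 0. -/
lemma exists_abs_quot_le {f : ℝ × ℝ → ℝ} (hf : ContDiffOn ℝ 1 f openChannel) {K : Set (ℝ × ℝ)}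
    (hK : IsCompact K) (hKU : K ⊆ openChannel) :
    ∃ C : ℝ, ∀ z ∈ K, ∀ h ∈ Ioc (0 : ℝ) 1, |quot h f z| ≤ C := by
  have hcomp : IsCompact ((fun p : (ℝ × ℝ) × ℝ => p.1 + (p.2, (0 : ℝ))) '' (K ×ˢ Icc (0 : ℝ) 1)) :=
    (hK.prod isCompact_Icc).image (by fun_prop)
  have hcont : ContinuousOn (dx f) openChannel := continuousOn_dir hf (1, 0)
  obtain ⟨C, hC⟩ := hcomp.exists_bound_of_continuousOn (hcont.mono (by
    rintro _ ⟨⟨z, s⟩, ⟨hz, hs⟩, rfl⟩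
    exact shift_mem_openChannel s (hKU hz)))
  refine ⟨C, fun z hz h hh => ?_⟩
  have := abs_shift_sub_le (C := C) hf (hKU hz) hh.1.le fun s hs =>
    hC _ ⟨(z, s), ⟨hz, hs.1, hs.2.trans hh.2⟩, rfl⟩
  rw [quot, abs_mul, abs_of_pos (inv_pos.2 hh.1), inv_mul_le_iff₀ hh.1]
  linarith

lemma dir_quot {f : ℝ × ℝ → ℝ} (hf : ContDiffOn ℝ 1 f openChannel) (h : ℝ) (v : ℝ × ℝ)
    {z : ℝ × ℝ} (hz : z ∈ openChannel) : dir v (quot h f) z = quot h (dir v f) z := by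
  have hd := fun {z} (hz : z ∈ openChannel) =>
    (hf.differentiableOn (by norm_num)).differentiableAt (isOpen_openChannel.mem_nhds hz)
  have h1 : DifferentiableAt ℝ (fun x => f (x + (h, 0))) z :=
    (hd (shift_mem_openChannel h hz)).comp z (by fun_prop)
  have h2 : DifferentiableAt ℝ (fun x => -f x) z := (hd hz).neg
  have e : quot h f = fun x => h⁻¹ * (f (x + (h, 0)) + -f x) := by
    funext x; simp only [quot, sub_eq_add_neg]
  rw [e, dir_const_mul]
  simp only
  rw [dir_add v h1 h2, dir_shift, dir_neg]
  simp only [quot, sub_eq_add_neg]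

lemma lap_quot_stream {ω ψ : ℝ × ℝ → ℝ} (hψ : IsStreamFunction ω ψ) (h : ℝ) {z : ℝ × ℝ}
    (hz : z ∈ openChannel) : lap (quot h ψ) z = -quot h ω z := by
  have e : quot h ψ = fun x => h⁻¹ * (ψ (x + (h, 0)) - ψ x) := rfl
  rw [e, lap_const_mul, lap_shift_sub hψ h hz, quot]
  ring

lemma lap_eq_zero_of_notMem_tsupport {G : ℝ × ℝ → ℝ} {z : ℝ × ℝ} (hz : z ∉ tsupport G) :
    lap G z = 0 := by
  simp only [lap, dx_eq_dir, dy_eq_dir]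
  rw [dir_eq_zero_of_notMem_tsupport _ fun h => hz (tsupport_dir_subset G _ h),
    dir_eq_zero_of_notMem_tsupport _ fun h => hz (tsupport_dir_subset G _ h), add_zero]

lemma continuous_lap {G : ℝ × ℝ → ℝ} (hG : ContDiff ℝ 2 G) : Continuous (lap G) := by
  have h2 : ∀ v, Continuous (dir v (dir v G)) := by
    intro v
    rw [← continuousOn_univ]
    rw [← contDiffOn_univ] at hG
    exact (contDiffOn_dir (m := 0) v (contDiffOn_dir (m := 1) v hG isOpen_univ (by norm_num))
      isOpen_univ (by norm_num)).continuousOn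
  exact (h2 (1, 0)).add (h2 (0, 1))

/-- The localized energy identity for `∂ₓψ`, which solves `-Δ(∂ₓψ) = ∂ₓω`. -/
lemma energy_stream {ω ψ G : ℝ × ℝ → ℝ} (hψ : IsStreamFunction ω ψ)
    (hω : ContDiffOn ℝ 1 ω openChannel) (hG : ContDiff ℝ 2 G) (hGc : HasCompactSupport G)
    (hGU : tsupport G ⊆ openChannel) :
    ∫ z, (G z * (2 * dx (dx ψ) z ^ 2 + 2 * dy (dx ψ) z ^ 2 - 2 * dx ψ z * dx ω z)
      - dx ψ z ^ 2 * lap G z) = 0 := by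
  -- Since ψ is only C², ∂ₓψ need not have classical second derivatives. Its difference quotient
  -- version is C² and satisfies the identity exactly; `F h` is that integrand, and dominated
  -- convergence gives the limit.
  set F : ℝ → ℝ × ℝ → ℝ := fun h z =>
    G z * (2 * quot h (dx ψ) z ^ 2 + 2 * quot h (dy ψ) z ^ 2 - 2 * quot h ψ z * quot h ω z)
      - quot h ψ z ^ 2 * lap G z with hF
  have hψ1 : ContDiffOn ℝ 1 ψ openChannel := hψ.contDiffOn.of_le (by norm_num)
  have hF0 : ∀ h, Integrable (F h) ∧ ∫ z, F h z = 0 := by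
    intro h
    have hq : ContDiffOn ℝ 2 (quot h ψ) openChannel :=
      contDiffOn_const.mul ((hψ.contDiffOn.comp (contDiff_id.add contDiff_const).contDiffOn
        fun x hx => shift_mem_openChannel h hx).sub hψ.contDiffOn)
    have key := energy_lap isOpen_openChannel hq hG hGc hGU
    have e : F h = fun z => G z * (2 * dx (quot h ψ) z ^ 2 + 2 * dy (quot h ψ) z ^ 2
        + 2 * quot h ψ z * lap (quot h ψ) z) - quot h ψ z ^ 2 * lap G z := by
      funext z
      by_cases hz : z ∈ openChannel
      · simp only [hF]
        rw [lap_quot_stream hψ h hz, dx_eq_dir (quot h ψ), dy_eq_dir (quot h ψ),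
          dir_quot hψ1 h _ hz, dir_quot hψ1 h _ hz, dx_eq_dir ψ, dy_eq_dir ψ]
        ring
      · have hz' : z ∉ tsupport G := fun h => hz (hGU h)
        simp [hF, lap_eq_zero_of_notMem_tsupport hz', image_eq_zero_of_notMem_tsupport hz']
    rw [e]
    exact key
  have hK : IsCompact (tsupport G) := hGc
  obtain ⟨C1, hC1⟩ := exists_abs_quot_le (contDiffOn_dx_stream hψ) hK hGU
  obtain ⟨C2, hC2⟩ := exists_abs_quot_le (contDiffOn_dy_stream hψ) hK hGU
  obtain ⟨C3, hC3⟩ := exists_abs_quot_le hψ1 hK hGU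
  obtain ⟨C4, hC4⟩ := exists_abs_quot_le hω hK hGU
  obtain ⟨A, hA⟩ := hK.exists_bound_of_continuousOn hG.continuous.continuousOn
  obtain ⟨B, hB⟩ := hK.exists_bound_of_continuousOn (continuous_lap hG).continuousOn
  set T : ℝ := A * (2 * C1 ^ 2 + 2 * C2 ^ 2 + 2 * C3 * C4) + C3 ^ 2 * B with hT
  have hlim := tendsto_integral_filter_of_dominated_convergence (μ := volume) (l := 𝓝[>] (0 : ℝ))
    (F := F) (f := fun z =>
      G z * (2 * dx (dx ψ) z ^ 2 + 2 * dy (dx ψ) z ^ 2 - 2 * dx ψ z * dx ω z)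
      - dx ψ z ^ 2 * lap G z) ((tsupport G).indicator fun _ => T)
    (Eventually.of_forall fun h => (hF0 h).1.aestronglyMeasurable)
    (by
      filter_upwards [Ioc_mem_nhdsGT (zero_lt_one' ℝ)] with h hh
      refine Eventually.of_forall fun z => ?_
      by_cases hz : z ∈ tsupport G
      · rw [indicator_of_mem hz, Real.norm_eq_abs]
        have a1 := hC1 z hz h hh
        have a2 := hC2 z hz h hh
        have a3 := hC3 z hz h hh
        have a4 := hC4 z hz h hh
        have a5 := hA z hz
        have a6 := hB z hz
        rw [Real.norm_eq_abs] at a5 a6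
        have b1 : quot h (dx ψ) z ^ 2 ≤ C1 ^ 2 := sq_le_sq' (abs_le.1 a1).1 (abs_le.1 a1).2
        have b2 : quot h (dy ψ) z ^ 2 ≤ C2 ^ 2 := sq_le_sq' (abs_le.1 a2).1 (abs_le.1 a2).2
        have b3 : quot h ψ z ^ 2 ≤ C3 ^ 2 := sq_le_sq' (abs_le.1 a3).1 (abs_le.1 a3).2
        have b4 : |quot h ψ z * quot h ω z| ≤ C3 * C4 := by
          rw [abs_mul]
          exact mul_le_mul a3 a4 (abs_nonneg _) ((abs_nonneg _).trans a3)
        refine (abs_sub _ _).trans (add_le_add ?_ ?_)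
        · rw [abs_mul]
          refine mul_le_mul a5 ?_ (abs_nonneg _) ((abs_nonneg _).trans a5)
          have := abs_le.1 b4
          refine abs_le.2 ⟨?_, ?_⟩ <;>
            nlinarith [sq_nonneg (quot h (dx ψ) z), sq_nonneg (quot h (dy ψ) z)]
        · rw [abs_mul, abs_of_nonneg (sq_nonneg _)]
          exact mul_le_mul b3 a6 (abs_nonneg _) (sq_nonneg _)
      · simp [indicator_of_notMem hz, hF, lap_eq_zero_of_notMem_tsupport hz, image_eq_zero_of_notMem_tsupport hz])
    ((integrable_indicator_iff hK.measurableSet).2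
      (integrableOn_const hK.measure_lt_top.ne))
    (Eventually.of_forall fun z => by
      by_cases hz : z ∈ tsupport G
      · have hzU := hGU hz
        have t1 := tendsto_quot (contDiffOn_dx_stream hψ) hzU
        have t2 := tendsto_quot (contDiffOn_dy_stream hψ) hzU
        -- The quotients of ∂_yψ converge to ∂ₓ∂_yψ; symmetry of the second derivative turns this
        -- into ∂_yφ.
        rw [dy_dx_stream hψ hzU] at t2
        have t3 := tendsto_quot hψ1 hzU
        have t4 := tendsto_quot hω hzU
        exact ((((t1.pow 2).const_mul 2).add ((t2.pow 2).const_mul 2)).sub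
          ((t3.const_mul 2).mul t4)).const_mul (G z) |>.sub ((t3.pow 2).mul_const (lap G z))
      · simp [hF, lap_eq_zero_of_notMem_tsupport hz, image_eq_zero_of_notMem_tsupport hz])
  have hc : (fun h => ∫ z, F h z) = fun _ => (0 : ℝ) := funext fun h => (hF0 h).2
  rw [hc] at hlim
  exact (tendsto_nhds_unique hlim tendsto_const_nhds)

/-! ### The inequality on a vertical slice -/

/-- Cauchy-Schwarz against 1, read off from the nonnegativity of the integral of (g - m)², where m
is the mean of g. -/
lemma sq_integral_le {g : ℝ → ℝ} {a b : ℝ} (hab : a < b) (hg : ContinuousOn g (Icc a b)) :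
    (∫ t in a..b, g t) ^ 2 ≤ (b - a) * ∫ t in a..b, g t ^ 2 := by
  have hu : uIcc a b = Icc a b := uIcc_of_le hab.le
  have hi : IntervalIntegrable g volume a b := (hu ▸ hg).intervalIntegrable
  have hi2 : IntervalIntegrable (fun t => g t ^ 2) volume a b :=
    (hu ▸ hg.pow 2 : ContinuousOn (fun t => g t ^ 2) (uIcc a b)).intervalIntegrable
  have hba : 0 < b - a := sub_pos.2 hab
  set I := ∫ t in a..b, g t with hI
  set m := I / (b - a) with hm
  have h0 : 0 ≤ ∫ t in a..b, (g t - m) ^ 2 :=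
    intervalIntegral.integral_nonneg hab.le fun t _ => sq_nonneg _
  have e : ∫ t in a..b, (g t - m) ^ 2 = (∫ t in a..b, g t ^ 2) - 2 * m * I + m ^ 2 * (b - a) := by
    have : ∀ t, (g t - m) ^ 2 = (g t ^ 2 - 2 * m * g t) + m ^ 2 := fun t => by ring
    simp_rw [this]
    rw [intervalIntegral.integral_add (hi2.sub (hi.const_mul _)) intervalIntegrable_const,
      intervalIntegral.integral_sub hi2 (hi.const_mul _), intervalIntegral.integral_const_mul,
      intervalIntegral.integral_const, smul_eq_mul]
    ring
  rw [e] at h0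
  have hmI : m * (b - a) = I := by rw [hm]; field_simp
  nlinarith

lemma sq_sub_le_mul_lintegral {f f' : ℝ → ℝ}
    (hf : ∀ y ∈ Ioo (-1 : ℝ) 1, HasDerivAt f (f' y) y) (hf' : ContinuousOn f' (Ioo (-1) 1))
    (hfin : ∫⁻ y in Ioo (-1 : ℝ) 1, ENNReal.ofReal (f' y ^ 2) ≠ ∞) {a b : ℝ}
    (ha : a ∈ Ioo (-1 : ℝ) 1) (hb : b ∈ Ioo (-1 : ℝ) 1) :
    (f b - f a) ^ 2 ≤ |b - a| * (∫⁻ y in Ioo (-1 : ℝ) 1, ENNReal.ofReal (f' y ^ 2)).toReal := by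
  wlog hab : a ≤ b generalizing a b
  · have := this hb ha (le_of_not_ge hab)
    rw [abs_sub_comm]
    linarith
  rcases hab.eq_or_lt with rfl | hab
  · simp
  have hsub : Icc a b ⊆ Ioo (-1 : ℝ) 1 := Icc_subset_Ioo ha.1 hb.2
  have hc : ContinuousOn f' (Icc a b) := hf'.mono hsub
  have hu : uIcc a b = Icc a b := uIcc_of_le hab.le
  have hftc : ∫ t in a..b, f' t = f b - f a :=
    intervalIntegral.integral_eq_sub_of_hasDerivAt (fun t ht => hf t (hsub (hu ▸ ht)))
      (hu ▸ hc).intervalIntegrable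
  rw [← hftc, abs_of_pos (sub_pos.2 hab)]
  refine (sq_integral_le hab hc).trans (mul_le_mul_of_nonneg_left ?_ (sub_pos.2 hab).le)
  rw [intervalIntegral.integral_of_le hab.le, integral_eq_lintegral_of_nonneg_ae
    (Eventually.of_forall fun t => sq_nonneg _)
    (((hc.pow 2).mono Ioc_subset_Icc_self).aestronglyMeasurable measurableSet_Ioc)]
  exact ENNReal.toReal_mono hfin
    (lintegral_mono_set (Ioc_subset_Icc_self.trans hsub))

/-- The constant in the slice inequality. -/
def sliceConst (α : ℝ) : ℝ≥0∞ := ∫⁻ t in Ioo (-2 : ℝ) 2, ENNReal.ofReal (1 + |t| ^ (α - 1))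

lemma sliceConst_ne_top {α : ℝ} (hα : 0 < α) : sliceConst α ≠ ∞ := by
  have h1 : IntegrableOn (fun t : ℝ => t ^ (α - 1)) (Ioo 0 2) :=
    (intervalIntegral.integrableOn_Ioo_rpow_iff (by norm_num)).2 (by linarith)
  have h2 : IntegrableOn (fun t : ℝ => |t| ^ (α - 1)) (Ioo 0 2) :=
    h1.congr_fun (fun t ht => by simp only [abs_of_pos ht.1]) measurableSet_Ioo
  have h3 : IntegrableOn (fun t : ℝ => |t| ^ (α - 1)) (Ioo (-2) 0) := by
    have := h2.comp_neg
    simpa using this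
  have h4 : IntegrableOn (fun t : ℝ => |t| ^ (α - 1)) (Ioo (-2) 2) := by
    have h5 := (h3.union (integrableOn_singleton (x := (0 : ℝ)) (μ := volume)
      (f := fun t : ℝ => |t| ^ (α - 1)) (by simp) (by simp))).union h2
    refine h5.mono_set fun t ht => ?_
    rcases lt_trichotomy t 0 with h | h | h
    · exact Or.inl (Or.inl ⟨ht.1, h⟩)
    · exact Or.inl (Or.inr h)
    · exact Or.inr ⟨h, ht.2⟩
  have h6 : IntegrableOn (fun t : ℝ => 1 + |t| ^ (α - 1)) (Ioo (-2) 2) :=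
    (integrableOn_const (by simp)).add h4
  exact h6.lintegral_lt_top.ne

lemma sliceConst_ne_zero (α : ℝ) : sliceConst α ≠ 0 := by
  have : (∫⁻ _ in Ioo (-2 : ℝ) 2, (1 : ℝ≥0∞)) ≤ sliceConst α :=
    lintegral_mono fun t => by
      rw [ENNReal.one_le_ofReal]
      linarith [Real.rpow_nonneg (abs_nonneg t) (α - 1)]
  intro h
  rw [h] at this
  norm_num at this

/-- The singular point Y changes from slice to slice. Every difference y - Y lies in (-2, 2), which
makes the constant independent of Y. -/
lemma lintegral_translate_le_sliceConst {α Y : ℝ} (hY : Y ∈ Icc (-1 : ℝ) 1) :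
    ∫⁻ y in Ioo (-1 : ℝ) 1, ENNReal.ofReal (1 + |y - Y| ^ (α - 1)) ≤ sliceConst α := by
  rw [sliceConst, ← lintegral_indicator measurableSet_Ioo, ← lintegral_indicator measurableSet_Ioo,
    ← lintegral_sub_right_eq_self (fun t => (Ioo (-2 : ℝ) 2).indicator
      (fun t => ENNReal.ofReal (1 + |t| ^ (α - 1))) t) Y]
  refine lintegral_mono fun y => ?_
  by_cases hy : y ∈ Ioo (-1 : ℝ) 1
  · rw [indicator_of_mem hy, indicator_of_mem]
    exact ⟨by linarith [hy.1, hY.2], by linarith [hy.2, hY.1]⟩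
  · simp [indicator_of_notMem hy]

/-- If `p q = f r` on `(-1, 1)`, where `f` vanishes at the ends, `p' ≥ 1/2` and `r` is small in the
Hölder norm, then `∫ |f q|` is controlled by `∫ f'²`: at the zero of `p` either `f` or `r`
vanishes. -/
lemma slice_inequality {f f' p p' q r : ℝ → ℝ} {C ε α : ℝ} (hε : 0 < ε)
    (hf : ∀ y ∈ Ioo (-1 : ℝ) 1, HasDerivAt f (f' y) y) (hf' : ContinuousOn f' (Ioo (-1) 1))
    (hfb : ∀ y ∈ Ioo (-1 : ℝ) 1, |f y| ≤ C * (1 - y ^ 2))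
    (hp : ∀ y ∈ Ioo (-1 : ℝ) 1, HasDerivAt p (p' y) y) (hp' : ∀ y ∈ Ioo (-1 : ℝ) 1, 1 / 2 ≤ p' y)
    (hpq : ∀ y ∈ Ioo (-1 : ℝ) 1, p y * q y = f y * r y)
    (hr : ∀ y ∈ Ioo (-1 : ℝ) 1, |r y| ≤ ε)
    (hrα : ∀ y ∈ Ioo (-1 : ℝ) 1, ∀ y' ∈ Ioo (-1 : ℝ) 1, y ≠ y' → |r y - r y'| ≤ ε * |y - y'| ^ α) :
    ∫⁻ y in Ioo (-1 : ℝ) 1, ENNReal.ofReal |f y * q y| ≤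
      ENNReal.ofReal (4 * ε) * sliceConst α *
        ∫⁻ y in Ioo (-1 : ℝ) 1, ENNReal.ofReal (f' y ^ 2) := by
  -- On a slice of infinite energy the right-hand side is infinite, because its coefficient is
  -- nonzero.
  by_cases hfin : ∫⁻ y in Ioo (-1 : ℝ) 1, ENNReal.ofReal (f' y ^ 2) = ∞
  · rw [hfin, ENNReal.mul_top]
    · exact le_top
    · exact mul_ne_zero (by simpa using hε) (sliceConst_ne_zero α)
  set A := (∫⁻ y in Ioo (-1 : ℝ) 1, ENNReal.ofReal (f' y ^ 2)).toReal with hA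
  have hA0 : 0 ≤ A := ENNReal.toReal_nonneg
  have hcs : ∀ a ∈ Ioo (-1 : ℝ) 1, ∀ b ∈ Ioo (-1 : ℝ) 1, (f b - f a) ^ 2 ≤ |b - a| * A :=
    fun a ha b hb => sq_sub_le_mul_lintegral hf hf' hfin ha hb
  have hpm : ∀ a ∈ Ioo (-1 : ℝ) 1, ∀ b ∈ Ioo (-1 : ℝ) 1, a ≤ b → 1 / 2 * (b - a) ≤ p b - p a :=
    fun a ha b hb hab => (convex_Ioo (-1 : ℝ) 1).mul_sub_le_image_sub_of_le_deriv
      (fun y hy => (hp y hy).continuousAt.continuousWithinAt)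
      (fun y hy => by
        rw [interior_Ioo] at hy
        exact (hp y hy).differentiableAt.differentiableWithinAt)
      (fun y hy => by
        rw [interior_Ioo] at hy
        rw [(hp y hy).deriv]; exact hp' y hy) a ha b hb hab
  have hflim : ∀ e : ℝ, e ^ 2 = 1 → ∀ l : Filter ℝ, l ≤ 𝓝 e → (∀ᶠ y in l, y ∈ Ioo (-1 : ℝ) 1) →
      Tendsto f l (𝓝 0) := by
    intro e he l hl hev
    have h1 : Tendsto (fun y : ℝ => C * (1 - y ^ 2)) l (𝓝 (C * (1 - e ^ 2))) :=
      ((by fun_prop : Continuous fun y : ℝ => C * (1 - y ^ 2)).tendsto e).mono_left hl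
    rw [he, sub_self, mul_zero] at h1
    refine squeeze_zero_norm' ?_ h1
    filter_upwards [hev] with y hy using hfb y hy
  have hevL : ∀ᶠ y in 𝓝[>] (-1 : ℝ), y ∈ Ioo (-1 : ℝ) 1 := Ioo_mem_nhdsGT (by norm_num)
  have hevR : ∀ᶠ y in 𝓝[<] (1 : ℝ), y ∈ Ioo (-1 : ℝ) 1 := Ioo_mem_nhdsLT (by norm_num)
  -- The Hölder-1/2 bound for `f` extends to the walls, with boundary value 0, by letting `a` tend
  -- to `e`.
  have hend : ∀ e : ℝ, e ^ 2 = 1 → ∀ l : Filter ℝ, l.NeBot → l ≤ 𝓝 e →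
      (∀ᶠ y in l, y ∈ Ioo (-1 : ℝ) 1) → ∀ b ∈ Ioo (-1 : ℝ) 1, f b ^ 2 ≤ |b - e| * A := by
    intro e he l hne hl hev b hb
    have h1 : Tendsto (fun a => (f b - f a) ^ 2) l (𝓝 ((f b - 0) ^ 2)) :=
      ((hflim e he l hl hev).const_sub (f b)).pow 2
    have h2 : Tendsto (fun a : ℝ => |b - a| * A) l (𝓝 (|b - e| * A)) :=
      ((by fun_prop : Continuous fun a : ℝ => |b - a| * A).tendsto e).mono_left hl
    rw [sub_zero] at h1
    refine le_of_tendsto_of_tendsto h1 h2 ?_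
    filter_upwards [hev] with a ha using hcs a ha b hb
  have hL := hend (-1) (by norm_num) (𝓝[>] (-1 : ℝ)) inferInstance nhdsWithin_le_nhds hevL
  have hR := hend 1 (by norm_num) (𝓝[<] (1 : ℝ)) inferInstance nhdsWithin_le_nhds hevR
  have hprod : ∀ y ∈ Ioo (-1 : ℝ) 1, |p y| * |f y * q y| = f y ^ 2 * |r y| := by
    intro y hy
    rw [← abs_mul, show p y * (f y * q y) = f y * (p y * q y) by ring, hpq y hy,
      show f y * (f y * r y) = f y ^ 2 * r y by ring, abs_mul, abs_of_nonneg (sq_nonneg _)]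
  -- Case where `f` vanishes at Y: the factor |y - Y| cancels and |f q| ≤ 2εA remains. The stated
  -- bound is larger so as to cover the other case as well.
  have hvan : ∀ Y y : ℝ, y ∈ Ioo (-1 : ℝ) 1 → y ≠ Y → 1 / 2 * |y - Y| ≤ |p y| →
      f y ^ 2 ≤ |y - Y| * A → |f y * q y| ≤ 4 * ε * A * (1 + |y - Y| ^ (α - 1)) := by
    intro Y y hy hne h1 h2
    have hd : 0 < |y - Y| := abs_pos.2 (sub_ne_zero.2 hne)
    have h3 : |y - Y| * (1 / 2 * |f y * q y|) ≤ |y - Y| * (A * ε) := by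
      calc |y - Y| * (1 / 2 * |f y * q y|) = 1 / 2 * |y - Y| * |f y * q y| := by ring
        _ ≤ |p y| * |f y * q y| := by gcongr
        _ = f y ^ 2 * |r y| := hprod y hy
        _ ≤ |y - Y| * A * ε := by
            gcongr
            exact hr y hy
        _ = |y - Y| * (A * ε) := by ring
    have h4 := le_of_mul_le_mul_left h3 hd
    have h5 : 0 ≤ |y - Y| ^ (α - 1) := Real.rpow_nonneg hd.le _
    nlinarith [mul_nonneg hA0 hε.le, mul_nonneg (mul_nonneg hA0 hε.le) h5]
  obtain ⟨Y, hY, hbound⟩ : ∃ Y ∈ Icc (-1 : ℝ) 1, ∀ y ∈ Ioo (-1 : ℝ) 1, y ≠ Y →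
      |f y * q y| ≤ 4 * ε * A * (1 + |y - Y| ^ (α - 1)) := by
    by_cases hzero : ∃ Y ∈ Ioo (-1 : ℝ) 1, p Y = 0
    · obtain ⟨Y, hY, hpY⟩ := hzero
      have hpl : ∀ y ∈ Ioo (-1 : ℝ) 1, 1 / 2 * |y - Y| ≤ |p y| := by
        intro y hy
        rcases le_total Y y with h | h
        · have := hpm Y hY y hy h
          rw [abs_of_nonneg (sub_nonneg.2 h)]
          exact (by linarith : _ ≤ p y).trans (le_abs_self _)
        · have := hpm y hy Y hY h
          rw [abs_sub_comm, abs_of_nonneg (sub_nonneg.2 h)]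
          exact (by linarith : _ ≤ -p y).trans (neg_le_abs _)
      refine ⟨Y, Ioo_subset_Icc_self hY, fun y hy hne => ?_⟩
      have hfr : f Y * r Y = 0 := by rw [← hpq Y hY, hpY, zero_mul]
      rcases mul_eq_zero.1 hfr with hf0 | hr0
      · refine hvan Y y hy hne (hpl y hy) ?_
        simpa [hf0] using hcs Y hY y hy
      -- Case where `r` vanishes at Y: f² ≤ 2A because `f` vanishes on the wall y = -1, and the
      -- Hölder bound on `r` divided by |y - Y| leaves the power α - 1.
      · have hd : 0 < |y - Y| := abs_pos.2 (sub_ne_zero.2 hne)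
        have hry : |r y| ≤ ε * (|y - Y| * |y - Y| ^ (α - 1)) := by
          have := hrα y hy Y hY hne
          rw [hr0, sub_zero] at this
          rwa [Real.rpow_sub_one hd.ne', mul_div_cancel₀ _ hd.ne']
        have hf2 : f y ^ 2 ≤ 2 * A := by
          refine (hL y hy).trans ?_
          gcongr
          rw [abs_le]
          constructor <;> linarith [hy.1, hy.2]
        have h5 : 0 ≤ |y - Y| ^ (α - 1) := Real.rpow_nonneg hd.le _
        have h3 : |y - Y| * (1 / 2 * |f y * q y|) ≤ |y - Y| * (2 * A * (ε * |y - Y| ^ (α - 1))) := by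
          calc |y - Y| * (1 / 2 * |f y * q y|) = 1 / 2 * |y - Y| * |f y * q y| := by ring
            _ ≤ |p y| * |f y * q y| := by
                gcongr
                exact hpl y hy
            _ = f y ^ 2 * |r y| := hprod y hy
            _ ≤ 2 * A * (ε * (|y - Y| * |y - Y| ^ (α - 1))) := by gcongr
            _ = _ := by ring
        have h4 := le_of_mul_le_mul_left h3 hd
        nlinarith [mul_nonneg hA0 hε.le, mul_nonneg (mul_nonneg hA0 hε.le) h5]
    -- Without a zero, `p` has constant sign; being increasing at rate at least 1/2, it dominates
    -- half the distance to the lower wall when positive and to the upper wall when negative. There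
    -- `f` vanishes, so `hvan` applies with Y on that wall.
    · push Not at hzero
      have hcont : ContinuousOn p (Ioo (-1) 1) := fun y hy =>
        (hp y hy).continuousAt.continuousWithinAt
      have hsign : (∀ y ∈ Ioo (-1 : ℝ) 1, 0 < p y) ∨ (∀ y ∈ Ioo (-1 : ℝ) 1, p y < 0) := by
        by_contra! hcon
        obtain ⟨⟨a, ha, hpa⟩, b, hb, hpb⟩ := hcon
        obtain ⟨Y, hY, hpY⟩ := (isPreconnected_Ioo.intermediate_value ha hb hcont) ⟨hpa, hpb⟩
        exact hzero Y hY hpY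
      rcases hsign with hpos | hneg
      · refine ⟨-1, by simp, fun y hy hne => hvan (-1) y hy hne ?_ (hL y hy)⟩
        have h1 : Tendsto (fun a : ℝ => 1 / 2 * |y - a|) (𝓝[>] (-1)) (𝓝 (1 / 2 * |y - -1|)) :=
          ((by fun_prop : Continuous fun a : ℝ => 1 / 2 * |y - a|).tendsto _).mono_left
            nhdsWithin_le_nhds
        refine le_of_tendsto h1 ?_
        filter_upwards [hevL, Ioo_mem_nhdsGT hy.1] with a ha hay
        have := hpm a ha y hy hay.2.le
        rw [abs_of_pos (sub_pos.2 hay.2)]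
        exact (by linarith [hpos a ha] : _ ≤ p y).trans (le_abs_self _)
      · refine ⟨1, by simp, fun y hy hne => hvan 1 y hy hne ?_ (hR y hy)⟩
        have h1 : Tendsto (fun a : ℝ => 1 / 2 * |y - a|) (𝓝[<] 1) (𝓝 (1 / 2 * |y - 1|)) :=
          ((by fun_prop : Continuous fun a : ℝ => 1 / 2 * |y - a|).tendsto _).mono_left
            nhdsWithin_le_nhds
        refine le_of_tendsto h1 ?_
        filter_upwards [hevR, Ioo_mem_nhdsLT hy.2] with a ha hay
        have := hpm y hy a ha hay.1.le
        rw [abs_sub_comm, abs_of_pos (sub_pos.2 hay.1)]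
        exact (by linarith [hneg a ha] : _ ≤ -p y).trans (neg_le_abs _)
  have hAe : ENNReal.ofReal A = ∫⁻ y in Ioo (-1 : ℝ) 1, ENNReal.ofReal (f' y ^ 2) :=
    ENNReal.ofReal_toReal hfin
  have hcoef : 0 ≤ 4 * ε * A := by positivity
  calc ∫⁻ y in Ioo (-1 : ℝ) 1, ENNReal.ofReal |f y * q y|
      ≤ ∫⁻ y in Ioo (-1 : ℝ) 1, ENNReal.ofReal (4 * ε * A) *
          ENNReal.ofReal (1 + |y - Y| ^ (α - 1)) := by
        refine lintegral_mono_ae ?_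
        have hne : ∀ᵐ y ∂(volume.restrict (Ioo (-1 : ℝ) 1)), y ≠ Y :=
          ae_restrict_of_ae (Measure.ae_ne volume Y)
        filter_upwards [ae_restrict_mem measurableSet_Ioo, hne] with y hy hyY
        rw [← ENNReal.ofReal_mul hcoef]
        exact ENNReal.ofReal_le_ofReal (hbound y hy hyY)
    _ = ENNReal.ofReal (4 * ε * A) *
          ∫⁻ y in Ioo (-1 : ℝ) 1, ENNReal.ofReal (1 + |y - Y| ^ (α - 1)) :=
        lintegral_const_mul' _ _ ENNReal.ofReal_ne_top
    _ ≤ ENNReal.ofReal (4 * ε * A) * sliceConst α := by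
        gcongr
        exact lintegral_translate_le_sliceConst hY
    _ = _ := by
        rw [ENNReal.ofReal_mul (by positivity), hAe]
        ring

/-! ### Cutoff functions -/

/-- An even cutoff function. -/
def cutoff (a b t : ℝ) : ℝ := Real.smoothTransition (a - b * t ^ 2)

lemma contDiff_cutoff (a b : ℝ) : ContDiff ℝ 2 (cutoff a b) :=
  (Real.smoothTransition.contDiff (n := 2)).comp (by fun_prop)

lemma cutoff_nonneg (a b t : ℝ) : 0 ≤ cutoff a b t := Real.smoothTransition.nonneg _

lemma cutoff_le_one (a b t : ℝ) : cutoff a b t ≤ 1 := Real.smoothTransition.le_one _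

lemma deriv_smoothTransition_eq_zero {t : ℝ} (ht : t ∉ Icc (0 : ℝ) 1) :
    deriv Real.smoothTransition t = 0 := by
  rw [mem_Icc, not_and_or, not_le, not_le] at ht
  rcases ht with h | h
  · have : Real.smoothTransition =ᶠ[𝓝 t] fun _ => 0 := by
      filter_upwards [Iio_mem_nhds h] with s hs using Real.smoothTransition.zero_of_nonpos (le_of_lt hs)
    simp [this.deriv_eq]
  · have : Real.smoothTransition =ᶠ[𝓝 t] fun _ => 1 := by
      filter_upwards [Ioi_mem_nhds h] with s hs using Real.smoothTransition.one_of_one_le (le_of_lt hs)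
    simp [this.deriv_eq]

lemma deriv_deriv_smoothTransition_eq_zero {t : ℝ} (ht : t ∉ Icc (0 : ℝ) 1) :
    deriv (deriv Real.smoothTransition) t = 0 := by
  have : deriv Real.smoothTransition =ᶠ[𝓝 t] fun _ => 0 := by
    filter_upwards [isClosed_Icc.isOpen_compl.mem_nhds ht] with s hs
      using deriv_smoothTransition_eq_zero hs
  simp [this.deriv_eq]

lemma contDiff_deriv_smoothTransition : ContDiff ℝ 1 (deriv Real.smoothTransition) := by
  have := (Real.smoothTransition.contDiff (n := 2)).iterate_deriv' 1 1
  simpa using this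

lemma exists_smoothTransition_bound : ∃ C : ℝ, 0 ≤ C ∧ ∀ t, |deriv Real.smoothTransition t| ≤ C ∧
    |deriv (deriv Real.smoothTransition) t| ≤ C := by
  obtain ⟨C1, h1⟩ := (isCompact_Icc (a := (0 : ℝ)) (b := 1)).exists_bound_of_continuousOn
    contDiff_deriv_smoothTransition.continuous.continuousOn
  obtain ⟨C2, h2⟩ := (isCompact_Icc (a := (0 : ℝ)) (b := 1)).exists_bound_of_continuousOn
    (contDiff_deriv_smoothTransition.continuous_deriv (by norm_num)).continuousOn
  refine ⟨max C1 C2, ?_, fun t => ?_⟩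
  · exact (norm_nonneg _).trans ((h1 0 (by simp)).trans (le_max_left _ _))
  · by_cases ht : t ∈ Icc (0 : ℝ) 1
    · exact ⟨(h1 t ht).trans (le_max_left _ _), (h2 t ht).trans (le_max_right _ _)⟩
    · rw [deriv_smoothTransition_eq_zero ht, deriv_deriv_smoothTransition_eq_zero ht, abs_zero,
        and_self]
      exact (norm_nonneg _).trans ((h1 0 (by simp)).trans (le_max_left _ _))

lemma deriv_deriv_cutoff (a b t : ℝ) : deriv (deriv (cutoff a b)) t =
    deriv (deriv Real.smoothTransition) (a - b * t ^ 2) * (2 * b * t) ^ 2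
      - deriv Real.smoothTransition (a - b * t ^ 2) * (2 * b) := by
  have hin : ∀ t : ℝ, HasDerivAt (fun t : ℝ => a - b * t ^ 2) (-(2 * b * t)) t := fun t => by
    have := ((hasDerivAt_pow 2 t).const_mul b).const_sub a
    refine this.congr_deriv ?_
    push_cast
    ring
  have h1 : deriv (cutoff a b) =
      fun t => deriv Real.smoothTransition (a - b * t ^ 2) * -(2 * b * t) := by
    funext t
    have hS : HasDerivAt Real.smoothTransition _ (a - b * t ^ 2) :=
      ((Real.smoothTransition.contDiff (n := 1)).differentiable (by norm_num) _).hasDerivAt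
    exact (hS.comp t (hin t)).deriv
  rw [h1]
  have hS : HasDerivAt (deriv Real.smoothTransition) _ (a - b * t ^ 2) :=
    (contDiff_deriv_smoothTransition.differentiable (by norm_num) _).hasDerivAt
  have h2 : HasDerivAt (fun t : ℝ => -(2 * b * t)) (-(2 * b)) t := by
    simpa using ((hasDerivAt_id t).const_mul (2 * b)).fun_neg
  have h3 := ((hS.comp t (hin t)).mul h2).deriv
  simp only [Function.comp_def] at h3
  refine Eq.trans h3 ?_
  ring

lemma dx_prod {g k : ℝ → ℝ} (hg : Differentiable ℝ g) (hk : Differentiable ℝ k) :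
    dx (fun z => g z.1 * k z.2) = fun z => deriv g z.1 * k z.2 := by
  funext z
  have h1 : HasFDerivAt (𝕜 := ℝ) (fun z : ℝ × ℝ => g z.1) _ z :=
    (hg z.1).hasDerivAt.comp_hasFDerivAt z (ContinuousLinearMap.fst ℝ ℝ ℝ).hasFDerivAt
  have h2 : HasFDerivAt (𝕜 := ℝ) (fun z : ℝ × ℝ => k z.2) _ z :=
    (hk z.2).hasDerivAt.comp_hasFDerivAt z (ContinuousLinearMap.snd ℝ ℝ ℝ).hasFDerivAt
  rw [dx, (h1.fun_mul h2).fderiv]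
  simp [mul_comm]

lemma dy_prod {g k : ℝ → ℝ} (hg : Differentiable ℝ g) (hk : Differentiable ℝ k) :
    dy (fun z => g z.1 * k z.2) = fun z => g z.1 * deriv k z.2 := by
  funext z
  have h1 : HasFDerivAt (𝕜 := ℝ) (fun z : ℝ × ℝ => g z.1) _ z :=
    (hg z.1).hasDerivAt.comp_hasFDerivAt z (ContinuousLinearMap.fst ℝ ℝ ℝ).hasFDerivAt
  have h2 : HasFDerivAt (𝕜 := ℝ) (fun z : ℝ × ℝ => k z.2) _ z :=
    (hk z.2).hasDerivAt.comp_hasFDerivAt z (ContinuousLinearMap.snd ℝ ℝ ℝ).hasFDerivAt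
  rw [dy, (h1.fun_mul h2).fderiv]
  simp

lemma lap_prod {g k : ℝ → ℝ} (hg : ContDiff ℝ 2 g) (hk : ContDiff ℝ 2 k) (z : ℝ × ℝ) :
    lap (fun z => g z.1 * k z.2) z =
      deriv (deriv g) z.1 * k z.2 + g z.1 * deriv (deriv k) z.2 := by
  have hd : ∀ {g : ℝ → ℝ}, ContDiff ℝ 2 g → Differentiable ℝ g ∧ Differentiable ℝ (deriv g) := by
    intro g hg
    have h1 : ContDiff ℝ 1 (deriv g) := by simpa using hg.iterate_deriv' 1 1
    exact ⟨hg.differentiable (by norm_num), h1.differentiable (by norm_num)⟩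
  rw [lap, dx_prod (hd hg).1 (hd hk).1, dy_prod (hd hg).1 (hd hk).1, dx_prod (hd hg).2 (hd hk).1,
    dy_prod (hd hg).1 (hd hk).2]

/-- The cutoff in the channel: horizontal scale `R`, vertical scale `1 / m`. -/
def weight (R m : ℝ) (z : ℝ × ℝ) : ℝ := cutoff 2 (R⁻¹ ^ 2) z.1 * cutoff (m - 1) m z.2

lemma contDiff_weight (R m : ℝ) : ContDiff ℝ 2 (weight R m) :=
  ((contDiff_cutoff _ _).comp contDiff_fst).mul ((contDiff_cutoff _ _).comp contDiff_snd)

lemma sq_le_of_cutoff_arg_nonneg {R x : ℝ} (hR : 0 < R) (h : 0 ≤ 2 - R⁻¹ ^ 2 * x ^ 2) :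
    x ^ 2 ≤ 2 * R ^ 2 := by
  have h1 : R⁻¹ ^ 2 * x ^ 2 * R ^ 2 = x ^ 2 := by field_simp
  nlinarith [sq_nonneg R]

lemma mem_Icc_of_sq_le {R x : ℝ} (hR : 0 < R) (h : x ^ 2 ≤ 2 * R ^ 2) :
    x ∈ Icc (-(2 * R)) (2 * R) :=
  abs_le.1 (abs_le_of_sq_le_sq (by nlinarith) (by positivity))

/-- The horizontal factor vanishes when x² ≥ 2R². The vertical factor is the smooth step at m(1 -
y²) - 1: it is 0 when 1 - y² ≤ 1/m and 1 when 1 - y² ≥ 2/m, so the support stays away from the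
walls. -/
lemma tsupport_weight_subset {R m : ℝ} (hR : 0 < R) (hm : 1 ≤ m) :
    tsupport (weight R m) ⊆
      Icc (-(2 * R)) (2 * R) ×ˢ Icc (-√(1 - m⁻¹)) (√(1 - m⁻¹)) := by
  refine closure_minimal (fun z hz => ?_) (isClosed_Icc.prod isClosed_Icc)
  have hz' := mul_ne_zero_iff.1 hz
  simp only [cutoff, ne_eq, Real.smoothTransition.zero_iff_nonpos, not_le] at hz'
  refine ⟨mem_Icc_of_sq_le hR (sq_le_of_cutoff_arg_nonneg hR hz'.1.le), abs_le.1 ?_⟩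
  refine Real.abs_le_sqrt ?_
  have h1 : m * m⁻¹ = 1 := mul_inv_cancel₀ (by positivity)
  nlinarith [hz'.2]

lemma hasCompactSupport_weight {R m : ℝ} (hR : 0 < R) (hm : 1 ≤ m) :
    HasCompactSupport (weight R m) :=
  (isCompact_Icc.prod isCompact_Icc).of_isClosed_subset (isClosed_tsupport _)
    (tsupport_weight_subset hR hm)

lemma tsupport_weight_subset_openChannel {R m : ℝ} (hR : 0 < R) (hm : 1 ≤ m) :
    tsupport (weight R m) ⊆ openChannel := by
  intro z hz
  have h := (tsupport_weight_subset hR hm hz).2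
  have hs : √(1 - m⁻¹) < 1 := by
    rw [Real.sqrt_lt' one_pos]
    have : 0 < m⁻¹ := by positivity
    linarith
  exact mem_openChannel.2 ⟨by linarith [h.1], by linarith [h.2]⟩

lemma abs_deriv_deriv_cutoff_le {C a b t : ℝ} (hb : 0 ≤ b)
    (hC : ∀ t, |deriv Real.smoothTransition t| ≤ C ∧ |deriv (deriv Real.smoothTransition) t| ≤ C) :
    |deriv (deriv (cutoff a b)) t| ≤ C * (4 * b ^ 2 * t ^ 2 + 2 * b) := by
  rw [deriv_deriv_cutoff]
  refine (abs_sub _ _).trans ?_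
  rw [abs_mul, abs_mul, abs_of_nonneg (sq_nonneg (2 * b * t)),
    abs_of_nonneg (by positivity : 0 ≤ 2 * b)]
  have h1 := mul_le_mul_of_nonneg_right (hC (a - b * t ^ 2)).2 (sq_nonneg (2 * b * t))
  have h2 := mul_le_mul_of_nonneg_right (hC (a - b * t ^ 2)).1 (by positivity : 0 ≤ 2 * b)
  linarith

lemma deriv_deriv_cutoff_eq_zero {a b t : ℝ} (h : a - b * t ^ 2 ∉ Icc (0 : ℝ) 1) :
    deriv (deriv (cutoff a b)) t = 0 := by
  rw [deriv_deriv_cutoff, deriv_smoothTransition_eq_zero h,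
    deriv_deriv_smoothTransition_eq_zero h]
  ring

/-- The horizontal cutoff has a second derivative of size `R⁻²`. -/
lemma abs_deriv_deriv_horizontal_le {C R : ℝ} (hC0 : 0 ≤ C) (hR : 0 < R)
    (hC : ∀ t, |deriv Real.smoothTransition t| ≤ C ∧ |deriv (deriv Real.smoothTransition) t| ≤ C)
    (x : ℝ) : |deriv (deriv (cutoff 2 (R⁻¹ ^ 2))) x| ≤
      (Icc (-(2 * R)) (2 * R)).indicator (fun _ => 10 * C * R⁻¹ ^ 2) x := by
  by_cases h : 2 - R⁻¹ ^ 2 * x ^ 2 ∈ Icc (0 : ℝ) 1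
  · have hx := sq_le_of_cutoff_arg_nonneg hR h.1
    rw [indicator_of_mem (mem_Icc_of_sq_le hR hx)]
    -- Here x² ≤ 2R², so 4R⁻⁴x² + 2R⁻² ≤ 10R⁻².
    refine (abs_deriv_deriv_cutoff_le (by positivity) hC).trans ?_
    have h2 : R⁻¹ ^ 2 * x ^ 2 ≤ 2 := by linarith [h.1]
    have h3 : 0 ≤ C * R⁻¹ ^ 2 := by positivity
    nlinarith [mul_le_mul_of_nonneg_left h2 h3]
  · rw [deriv_deriv_cutoff_eq_zero h, abs_zero]
    exact indicator_nonneg (fun _ _ => by positivity) x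

/-- The second derivative of the vertical cutoff, weighted by the square of a function that vanishes
linearly on the walls, is bounded and lives in thin layers. -/
lemma sq_mul_abs_deriv_deriv_vertical_le {C m y : ℝ} (hC0 : 0 ≤ C) (hm : 1 ≤ m)
    (hC : ∀ t, |deriv Real.smoothTransition t| ≤ C ∧ |deriv (deriv Real.smoothTransition) t| ≤ C)
    (hy : y ∈ Ioo (-1 : ℝ) 1) : (1 - y ^ 2) ^ 2 * |deriv (deriv (cutoff (m - 1) m)) y| ≤
      (Icc (-1) (-1 + 2 / m) ∪ Icc (1 - 2 / m) 1).indicator (fun _ => 24 * C) y := by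
  have hm0 : 0 < m := by linarith
  by_cases h : m - 1 - m * y ^ 2 ∈ Icc (0 : ℝ) 1
  · have hy2 : y ^ 2 ≤ 1 := by nlinarith [hy.1, hy.2]
    have h2 : m * (1 - y ^ 2) ≤ 2 := by linarith [h.2]
    have h3 : 1 - y ^ 2 ≤ 2 / m := by rw [le_div_iff₀ hm0]; linarith
    rw [indicator_of_mem]
    · calc (1 - y ^ 2) ^ 2 * |deriv (deriv (cutoff (m - 1) m)) y|
          ≤ (1 - y ^ 2) ^ 2 * (C * (4 * m ^ 2 * y ^ 2 + 2 * m)) := by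
            gcongr
            exact abs_deriv_deriv_cutoff_le hm0.le hC
        _ ≤ (1 - y ^ 2) ^ 2 * (C * (6 * m ^ 2)) := by
            gcongr
            nlinarith [sq_nonneg m]
        _ = 6 * C * (m * (1 - y ^ 2)) ^ 2 := by ring
        _ ≤ 6 * C * 2 ^ 2 := by
            have : 0 ≤ m * (1 - y ^ 2) := mul_nonneg hm0.le (by linarith)
            gcongr
        _ = 24 * C := by ring
    · rcases le_total 0 y with h0 | h0
      · exact Or.inr ⟨by nlinarith [hy.2], hy.2.le⟩
      · exact Or.inl ⟨hy.1.le, by nlinarith [hy.1]⟩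
  · rw [deriv_deriv_cutoff_eq_zero h, abs_zero, mul_zero]
    exact indicator_nonneg (fun _ _ => by positivity) y

/-! ### The energy inequality up to the walls -/

lemma integrable_mul_of_tsupport_subset {U : Set (ℝ × ℝ)} (hU : IsOpen U) {g k : ℝ × ℝ → ℝ}
    (hg : Continuous g) (hgc : HasCompactSupport g) (hgU : tsupport g ⊆ U)
    (hk : ContinuousOn k U) : Integrable (fun z => g z * k z) := by
  have hs : tsupport (fun z => g z * k z) ⊆ tsupport g := tsupport_mul_subset_left
  have hc : Continuous (fun z => g z * k z) := by
    refine continuous_iff_continuousAt.2 fun z => ?_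
    by_cases hz : z ∈ tsupport (fun z => g z * k z)
    · exact (hg.continuousOn.mul hk).continuousAt (hU.mem_nhds (hgU (hs hz)))
    · exact continuousAt_const.congr (notMem_tsupport_iff_eventuallyEq.1 hz).symm
  exact hc.integrable_of_hasCompactSupport
    (hgc.of_isClosed_subset (isClosed_tsupport _) hs)

lemma lintegral_le_of_integral_sub_eq_zero {f₁ f₂ f₃ : ℝ × ℝ → ℝ} (h₁ : Integrable f₁)
    (h₂ : Integrable f₂) (h₃ : Integrable f₃) (hpos : ∀ z, 0 ≤ f₁ z)
    (h : ∫ z, (f₁ z - f₂ z - f₃ z) = 0) :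
    ∫⁻ z, ENNReal.ofReal (f₁ z) ≤
      (∫⁻ z, ENNReal.ofReal |f₂ z|) + ∫⁻ z, ENNReal.ofReal |f₃ z| := by
  have h12 : Integrable (fun z => f₁ z - f₂ z) := h₁.sub h₂
  have e : ∫ z, f₁ z = (∫ z, f₂ z) + ∫ z, f₃ z := by
    rw [integral_sub h12 h₃, integral_sub h₁ h₂] at h
    linarith
  have hle : ∀ f : ℝ × ℝ → ℝ, ENNReal.ofReal (∫ z, f z) ≤ ∫⁻ z, ENNReal.ofReal |f z| := by
    intro f
    have := enorm_integral_le_lintegral_enorm (μ := volume) f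
    simp only [Real.enorm_eq_ofReal_abs] at this
    exact (ENNReal.ofReal_le_ofReal (le_abs_self _)).trans this
  rw [← ofReal_integral_eq_lintegral_ofReal h₁ (Eventually.of_forall hpos), e]
  exact ENNReal.ofReal_add_le.trans (add_le_add (hle f₂) (hle f₃))

section Energy

variable {ω ψ : ℝ × ℝ → ℝ} {ε : ℝ}

lemma energy_weight_integrable (hψ : IsStreamFunction ω ψ) {R m : ℝ} (hR : 0 < R) (hm : 1 ≤ m) :
    Integrable (fun z => weight R m z * (dx (dx ψ) z ^ 2 + dy (dx ψ) z ^ 2)) :=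
  integrable_mul_of_tsupport_subset isOpen_openChannel (contDiff_weight R m).continuous
    (hasCompactSupport_weight hR hm) (tsupport_weight_subset_openChannel hR hm)
    (((continuousOn_dir (contDiffOn_dx_stream hψ) (1, 0)).pow 2).add
      ((continuousOn_dir (contDiffOn_dx_stream hψ) (0, 1)).pow 2))

lemma weight_nonneg (R m : ℝ) (z : ℝ × ℝ) : 0 ≤ weight R m z :=
  mul_nonneg (cutoff_nonneg _ _ _) (cutoff_nonneg _ _ _)

lemma weight_le (R m : ℝ) (z : ℝ × ℝ) : weight R m z ≤ cutoff 2 (R⁻¹ ^ 2) z.1 :=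
  mul_le_of_le_one_right (cutoff_nonneg _ _ _) (cutoff_le_one _ _ _)

lemma lintegral_weight_le (hψ : IsStreamFunction ω ψ) (hω : ContDiffOn ℝ 1 ω openChannel)
    {R m : ℝ} (hR : 0 < R) (hm : 1 ≤ m) :
    ∫⁻ z, ENNReal.ofReal (weight R m z * (dx (dx ψ) z ^ 2 + dy (dx ψ) z ^ 2)) ≤
      (∫⁻ z in openChannel, ENNReal.ofReal (cutoff 2 (R⁻¹ ^ 2) z.1 * |dx ψ z * dx ω z|)) +
      ∫⁻ z in openChannel, ENNReal.ofReal (dx ψ z ^ 2 * |lap (weight R m) z|) := by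
  have hw := contDiff_weight R m
  have hwc := hasCompactSupport_weight hR hm
  have hwU := tsupport_weight_subset_openChannel hR hm
  have hφ := (contDiffOn_dx_stream hψ).continuousOn
  have h2 : Integrable (fun z => weight R m z * (dx ψ z * dx ω z)) :=
    integrable_mul_of_tsupport_subset isOpen_openChannel hw.continuous hwc hwU
      (hφ.mul (continuousOn_dir hω (1, 0)))
  have hls : tsupport (lap (weight R m)) ⊆ tsupport (weight R m) :=
    closure_minimal (fun z hz => by
      by_contra hn
      exact hz (lap_eq_zero_of_notMem_tsupport hn)) (isClosed_tsupport _)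
  have h3 : Integrable (fun z => lap (weight R m) z * (dx ψ z ^ 2 / 2)) :=
    integrable_mul_of_tsupport_subset isOpen_openChannel (continuous_lap hw)
      (hwc.of_isClosed_subset (isClosed_tsupport _) hls) (hls.trans hwU)
      ((hφ.pow 2).div_const 2)
  have hid := energy_stream hψ hω hw hwc hwU
  have hid' : ∫ z, (weight R m z * (dx (dx ψ) z ^ 2 + dy (dx ψ) z ^ 2)
      - weight R m z * (dx ψ z * dx ω z) - lap (weight R m) z * (dx ψ z ^ 2 / 2)) = 0 := by
    have e : ∀ z, weight R m z * (dx (dx ψ) z ^ 2 + dy (dx ψ) z ^ 2)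
      - weight R m z * (dx ψ z * dx ω z) - lap (weight R m) z * (dx ψ z ^ 2 / 2)
      = 2⁻¹ * (weight R m z * (2 * dx (dx ψ) z ^ 2 + 2 * dy (dx ψ) z ^ 2 - 2 * dx ψ z * dx ω z)
      - dx ψ z ^ 2 * lap (weight R m) z) := fun z => by ring
    simp_rw [e]
    rw [integral_const_mul, hid, mul_zero]
  have hmeas : MeasurableSet openChannel := isOpen_openChannel.measurableSet
  refine (lintegral_le_of_integral_sub_eq_zero (energy_weight_integrable hψ hR hm) h2 h3
    (fun z => mul_nonneg (weight_nonneg R m z) (by positivity)) hid').trans (add_le_add ?_ ?_)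
  · rw [← lintegral_indicator hmeas]
    refine lintegral_mono fun z => ?_
    by_cases hz : z ∈ openChannel
    · rw [indicator_of_mem hz, abs_mul, abs_of_nonneg (weight_nonneg R m z)]
      exact ENNReal.ofReal_le_ofReal
        (mul_le_mul_of_nonneg_right (weight_le R m z) (abs_nonneg _))
    · simp [image_eq_zero_of_notMem_tsupport fun h => hz (hwU h)]
  · rw [← lintegral_indicator hmeas]
    refine lintegral_mono fun z => ?_
    by_cases hz : z ∈ openChannel
    · rw [indicator_of_mem hz, abs_mul, abs_of_nonneg (by positivity : 0 ≤ dx ψ z ^ 2 / 2)]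
      refine ENNReal.ofReal_le_ofReal ?_
      nlinarith [mul_nonneg (sq_nonneg (dx ψ z)) (abs_nonneg (lap (weight R m) z))]
    · simp [lap_eq_zero_of_notMem_tsupport fun h => hz (hwU h)]

/-- The error terms produced by the cutoff. -/
lemma lintegral_sq_mul_lap_weight_le (hψ : IsStreamFunction ω ψ)
    (hω : ContDiffOn ℝ 1 ω openChannel) (hε : 0 ≤ ε) (hdx : ∀ z ∈ openChannel, |dx ω z| ≤ ε)
    {C : ℝ} (hC0 : 0 ≤ C)
    (hC : ∀ t, |deriv Real.smoothTransition t| ≤ C ∧ |deriv (deriv Real.smoothTransition) t| ≤ C)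
    {R m : ℝ} (hR : 0 < R) (hm : 1 ≤ m) :
    ∫⁻ z in openChannel, ENNReal.ofReal (dx ψ z ^ 2 * |lap (weight R m) z|) ≤
      ENNReal.ofReal (80 * C * ε ^ 2 / R) + ENNReal.ofReal (384 * C * ε ^ 2 * R / m) := by
  have hm0 : 0 < m := by linarith
  set I := Icc (-(2 * R)) (2 * R) with hI
  set J := Icc (-1) (-1 + 2 / m) ∪ Icc (1 - 2 / m) 1 with hJ
  have hb : ∀ z ∈ openChannel, ENNReal.ofReal (dx ψ z ^ 2 * |lap (weight R m) z|) ≤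
      (I ×ˢ Ioo (-1) 1).indicator (fun _ => ENNReal.ofReal (10 * C * ε ^ 2 * R⁻¹ ^ 2)) z +
      (I ×ˢ J).indicator (fun _ => ENNReal.ofReal (24 * C * ε ^ 2)) z := by
    rintro ⟨x, y⟩ hz
    have hy : y ∈ Ioo (-1 : ℝ) 1 := mem_openChannel.1 hz
    have hy2 : 0 ≤ 1 - y ^ 2 := by nlinarith [hy.1, hy.2]
    have hφ : dx ψ (x, y) ^ 2 ≤ (ε * (1 - y ^ 2)) ^ 2 := by
      rw [← sq_abs]
      have := abs_dx_stream_le hψ hω hdx hz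
      have h0 := mul_nonneg hε hy2
      exact pow_le_pow_left₀ (abs_nonneg _) (by simp only at this; linarith) 2
    have hlap : lap (weight R m) (x, y) = deriv (deriv (cutoff 2 (R⁻¹ ^ 2))) x * cutoff (m - 1) m y
        + cutoff 2 (R⁻¹ ^ 2) x * deriv (deriv (cutoff (m - 1) m)) y :=
      lap_prod (contDiff_cutoff _ _) (contDiff_cutoff _ _) (x, y)
    by_cases hx : x ∈ I
    · have e1 := abs_deriv_deriv_horizontal_le hC0 hR hC x
      rw [indicator_of_mem hx] at e1
      have e2 := sq_mul_abs_deriv_deriv_vertical_le hC0 hm hC hy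
      have hbound : dx ψ (x, y) ^ 2 * |lap (weight R m) (x, y)| ≤ 10 * C * ε ^ 2 * R⁻¹ ^ 2 +
          J.indicator (fun _ => 24 * C) y * ε ^ 2 := by
        have a1 : |lap (weight R m) (x, y)| ≤ 10 * C * R⁻¹ ^ 2
            + |deriv (deriv (cutoff (m - 1) m)) y| := by
          rw [hlap]
          refine (abs_add_le _ _).trans (add_le_add ?_ ?_)
          · rw [abs_mul, abs_of_nonneg (cutoff_nonneg (m - 1) m y)]
            exact (mul_le_of_le_one_right (abs_nonneg _) (cutoff_le_one _ _ _)).trans e1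
          · rw [abs_mul, abs_of_nonneg (cutoff_nonneg 2 _ x)]
            exact mul_le_of_le_one_left (abs_nonneg _) (cutoff_le_one _ _ _)
        have a2 : (1 - y ^ 2) ^ 2 ≤ 1 := by nlinarith [sq_nonneg y]
        calc dx ψ (x, y) ^ 2 * |lap (weight R m) (x, y)|
            ≤ (ε * (1 - y ^ 2)) ^ 2 * (10 * C * R⁻¹ ^ 2 + |deriv (deriv (cutoff (m - 1) m)) y|) :=
              mul_le_mul hφ a1 (abs_nonneg _) (sq_nonneg _)
          _ = 10 * C * ε ^ 2 * R⁻¹ ^ 2 * (1 - y ^ 2) ^ 2 +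
              (1 - y ^ 2) ^ 2 * |deriv (deriv (cutoff (m - 1) m)) y| * ε ^ 2 := by ring
          _ ≤ 10 * C * ε ^ 2 * R⁻¹ ^ 2 + J.indicator (fun _ => 24 * C) y * ε ^ 2 := by
              refine add_le_add (mul_le_of_le_one_right (by positivity) a2) ?_
              exact mul_le_mul_of_nonneg_right e2 (sq_nonneg _)
      refine (ENNReal.ofReal_le_ofReal hbound).trans (ENNReal.ofReal_add_le.trans ?_)
      rw [indicator_of_mem (mk_mem_prod hx hy)]
      refine add_le_add le_rfl ?_
      by_cases hyJ : y ∈ J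
      · rw [indicator_of_mem hyJ, indicator_of_mem (mk_mem_prod hx hyJ)]
      · simp [indicator_of_notMem hyJ]
    · have hx2 : 2 - R⁻¹ ^ 2 * x ^ 2 < 0 := by
        by_contra! h
        exact hx (mem_Icc_of_sq_le hR (sq_le_of_cutoff_arg_nonneg hR h))
      have e1 : cutoff 2 (R⁻¹ ^ 2) x = 0 := Real.smoothTransition.zero_of_nonpos hx2.le
      have e2 : deriv (deriv (cutoff 2 (R⁻¹ ^ 2))) x = 0 :=
        deriv_deriv_cutoff_eq_zero fun h => absurd h.1 (not_le.2 hx2)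
      rw [hlap, e1, e2, zero_mul, zero_mul, add_zero, abs_zero, mul_zero, ENNReal.ofReal_zero]
      exact zero_le
  have hIm : MeasurableSet (I ×ˢ Ioo (-1 : ℝ) 1) := measurableSet_Icc.prod measurableSet_Ioo
  have hJm : MeasurableSet (I ×ˢ J) :=
    measurableSet_Icc.prod (measurableSet_Icc.union measurableSet_Icc)
  have hvI : volume I = ENNReal.ofReal (4 * R) := by
    rw [hI, Real.volume_Icc]
    congr 1
    ring
  have hvJ : volume J ≤ ENNReal.ofReal (4 / m) := by
    refine (measure_union_le _ _).trans ?_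
    rw [Real.volume_Icc, Real.volume_Icc, ← ENNReal.ofReal_add (by ring_nf; positivity)
      (by ring_nf; positivity)]
    exact ENNReal.ofReal_le_ofReal (le_of_eq (by ring))
  calc ∫⁻ z in openChannel, ENNReal.ofReal (dx ψ z ^ 2 * |lap (weight R m) z|)
      ≤ ∫⁻ z in openChannel,
        ((I ×ˢ Ioo (-1) 1).indicator (fun _ => ENNReal.ofReal (10 * C * ε ^ 2 * R⁻¹ ^ 2)) z +
        (I ×ˢ J).indicator (fun _ => ENNReal.ofReal (24 * C * ε ^ 2)) z) :=
        setLIntegral_mono' isOpen_openChannel.measurableSet hb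
    _ ≤ ∫⁻ z,
        ((I ×ˢ Ioo (-1) 1).indicator (fun _ => ENNReal.ofReal (10 * C * ε ^ 2 * R⁻¹ ^ 2)) z +
        (I ×ˢ J).indicator (fun _ => ENNReal.ofReal (24 * C * ε ^ 2)) z) :=
        setLIntegral_le_lintegral _ _
    _ = ENNReal.ofReal (10 * C * ε ^ 2 * R⁻¹ ^ 2) * volume (I ×ˢ Ioo (-1 : ℝ) 1) +
        ENNReal.ofReal (24 * C * ε ^ 2) * volume (I ×ˢ J) := by
        rw [lintegral_add_left (measurable_const.indicator hIm),
          lintegral_indicator_const hIm, lintegral_indicator_const hJm]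
    -- The horizontal error lives on a rectangle of area 8R. The vertical one lives on layers of
    -- total area at most 16R/m, and so vanishes as m grows with R fixed.
    _ ≤ ENNReal.ofReal (10 * C * ε ^ 2 * R⁻¹ ^ 2) * (ENNReal.ofReal (4 * R) * ENNReal.ofReal 2) +
        ENNReal.ofReal (24 * C * ε ^ 2) * (ENNReal.ofReal (4 * R) * ENNReal.ofReal (4 / m)) := by
        rw [Measure.volume_eq_prod, Measure.prod_prod, Measure.prod_prod, hvI, Real.volume_Ioo]
        gcongr
        norm_num
    _ = _ := by
        rw [← ENNReal.ofReal_mul (by positivity), ← ENNReal.ofReal_mul (by positivity),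
          ← ENNReal.ofReal_mul (by positivity), ← ENNReal.ofReal_mul (by positivity)]
        congr 2
        · field_simp
          ring
        · ring

/-- The energy inequality, after removal of the vertical cutoff. -/
lemma energy_inequality (hψ : IsStreamFunction ω ψ) (hω : ContDiffOn ℝ 1 ω openChannel)
    (hε : 0 ≤ ε) (hdx : ∀ z ∈ openChannel, |dx ω z| ≤ ε) {C : ℝ} (hC0 : 0 ≤ C)
    (hC : ∀ t, |deriv Real.smoothTransition t| ≤ C ∧ |deriv (deriv Real.smoothTransition) t| ≤ C)
    {R : ℝ} (hR : 0 < R) :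
    ∫⁻ z in openChannel, ENNReal.ofReal
        (cutoff 2 (R⁻¹ ^ 2) z.1 * (dx (dx ψ) z ^ 2 + dy (dx ψ) z ^ 2)) ≤
      (∫⁻ z in openChannel, ENNReal.ofReal (cutoff 2 (R⁻¹ ^ 2) z.1 * |dx ψ z * dx ω z|)) +
      ENNReal.ofReal (80 * C * ε ^ 2 / R) := by
  set B := (∫⁻ z in openChannel, ENNReal.ofReal (cutoff 2 (R⁻¹ ^ 2) z.1 * |dx ψ z * dx ω z|)) +
      ENNReal.ofReal (80 * C * ε ^ 2 / R) with hB
  set F : ℕ → ℝ × ℝ → ℝ≥0∞ := fun n z =>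
    ENNReal.ofReal (weight R (n + 1) z * (dx (dx ψ) z ^ 2 + dy (dx ψ) z ^ 2)) with hF
  have hm : ∀ n : ℕ, (1 : ℝ) ≤ n + 1 := fun n => by linarith [Nat.cast_nonneg (α := ℝ) n]
  have hle : ∀ n : ℕ, ∫⁻ z in openChannel, F n z ≤
      B + ENNReal.ofReal (384 * C * ε ^ 2 * R / (n + 1)) := by
    intro n
    refine (setLIntegral_le_lintegral _ _).trans ((lintegral_weight_le hψ hω hR (hm n)).trans ?_)
    rw [hB, add_assoc]
    exact add_le_add le_rfl (lintegral_sq_mul_lap_weight_le hψ hω hε hdx hC0 hC hR (hm n))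
  have hlim : Tendsto (fun n : ℕ => B + ENNReal.ofReal (384 * C * ε ^ 2 * R / (n + 1))) atTop
      (𝓝 (B + 0)) := by
    refine tendsto_const_nhds.add ?_
    rw [← ENNReal.ofReal_zero]
    refine ENNReal.tendsto_ofReal ?_
    have := (tendsto_one_div_add_atTop_nhds_zero_nat (𝕜 := ℝ)).const_mul (384 * C * ε ^ 2 * R)
    simpa [div_eq_mul_inv] using this
  -- At a fixed point the vertical cutoff equals 1 once (n + 1)(1 - y²) ≥ 2; Fatou's lemma then
  -- removes it.
  have hpt : ∀ z ∈ openChannel, liminf (fun n => F n z) atTop = ENNReal.ofReal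
        (cutoff 2 (R⁻¹ ^ 2) z.1 * (dx (dx ψ) z ^ 2 + dy (dx ψ) z ^ 2)) := by
    intro z hz
    refine Tendsto.liminf_eq (tendsto_const_nhds.congr' ?_)
    obtain ⟨h1, h2⟩ := mem_openChannel.1 hz
    have hy : 0 < 1 - z.2 ^ 2 := by nlinarith
    obtain ⟨N, hN⟩ := exists_nat_gt (2 / (1 - z.2 ^ 2))
    filter_upwards [eventually_ge_atTop N] with n hn
    have hn' : (N : ℝ) ≤ n := by exact_mod_cast hn
    have h3 : 2 < N * (1 - z.2 ^ 2) := (div_lt_iff₀ hy).1 hN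
    have h4 : cutoff ((n + 1 : ℝ) - 1) (n + 1) z.2 = 1 := by
      refine Real.smoothTransition.one_of_one_le ?_
      nlinarith
    simp only [hF, weight, h4, mul_one]
  calc ∫⁻ z in openChannel, ENNReal.ofReal
        (cutoff 2 (R⁻¹ ^ 2) z.1 * (dx (dx ψ) z ^ 2 + dy (dx ψ) z ^ 2))
      = ∫⁻ z in openChannel, liminf (fun n => F n z) atTop :=
        (setLIntegral_congr_fun isOpen_openChannel.measurableSet hpt).symm
    _ ≤ liminf (fun n => ∫⁻ z in openChannel, F n z) atTop :=
        lintegral_liminf_le' fun n =>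
          (energy_weight_integrable hψ hR (hm n)).aemeasurable.restrict.ennreal_ofReal
    _ ≤ liminf (fun n : ℕ => B + ENNReal.ofReal (384 * C * ε ^ 2 * R / (n + 1))) atTop :=
        liminf_le_liminf (Eventually.of_forall hle)
    _ = B := by rw [hlim.liminf_eq, add_zero]

end Energy

/-! ### Vertical slices, Hölder bounds and the steady equation -/

lemma hasDerivAt_vertical {f : ℝ × ℝ → ℝ} (hf : ContDiffOn ℝ 1 f openChannel) {x y : ℝ}
    (hy : y ∈ Ioo (-1 : ℝ) 1) : HasDerivAt (fun s : ℝ => f (x, s)) (dy f (x, y)) y := by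
  have := hasDerivAt_line (f := f) (z := (x, 0)) (v := (0, 1)) (t := y)
    ((hf.differentiableOn (by norm_num)).differentiableAt
      (isOpen_openChannel.mem_nhds (by simpa [mem_openChannel] using hy)))
  simpa [dy_eq_dir] using this

lemma lintegral_openChannel {f : ℝ × ℝ → ℝ} (hf : ContinuousOn f openChannel) :
    ∫⁻ z in openChannel, ENNReal.ofReal (f z) =
      ∫⁻ x, ∫⁻ y in Ioo (-1 : ℝ) 1, ENNReal.ofReal (f (x, y)) := by
  have hm : AEMeasurable (fun z => ENNReal.ofReal (f z)) (volume.restrict openChannel) :=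
    (hf.aemeasurable isOpen_openChannel.measurableSet).ennreal_ofReal
  have e : (volume : Measure (ℝ × ℝ)).restrict openChannel =
      (volume : Measure ℝ).prod ((volume : Measure ℝ).restrict (Ioo (-1) 1)) := by
    rw [openChannel, Measure.volume_eq_prod, ← Measure.prod_restrict, Measure.restrict_univ]
  rw [e] at hm ⊢
  exact lintegral_prod _ hm

section Bounds

variable {α ε : ℝ} {ω : ℝ × ℝ → ℝ}

lemma abs_fst_le_euclid (v : ℝ × ℝ) : |v.1| ≤ euclid v :=
  Real.abs_le_sqrt (by nlinarith [sq_nonneg v.2])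

lemma abs_snd_le_euclid (v : ℝ × ℝ) : |v.2| ≤ euclid v :=
  Real.abs_le_sqrt (by nlinarith [sq_nonneg v.1])

lemma abs_le_of_holderNorm_le (hε : 0 ≤ ε) (h : holderNorm α ω ≤ ENNReal.ofReal ε) {z : ℝ × ℝ}
    (hz : z ∈ channel) : |ω z| ≤ ε := by
  refine (ENNReal.ofReal_le_ofReal_iff hε).1 (le_trans ?_ h)
  exact (le_iSup₂ (f := fun z (_ : z ∈ channel) => ENNReal.ofReal |ω z|) z hz).trans
    (le_self_add.trans le_self_add)

lemma euclid_grad_le_of_holderNorm_le (hε : 0 ≤ ε) (h : holderNorm α ω ≤ ENNReal.ofReal ε)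
    {z : ℝ × ℝ} (hz : z ∈ openChannel) : euclid (grad ω z) ≤ ε := by
  refine (ENNReal.ofReal_le_ofReal_iff hε).1 (le_trans ?_ h)
  exact (le_iSup₂ (f := fun z (_ : z ∈ openChannel) => ENNReal.ofReal (euclid (grad ω z))) z hz).trans
    (le_add_self.trans le_self_add)

lemma abs_dy_sub_le_of_holderNorm_le (hε : 0 ≤ ε) (h : holderNorm α ω ≤ ENNReal.ofReal ε)
    {x y y' : ℝ} (hy : y ∈ Ioo (-1 : ℝ) 1) (hy' : y' ∈ Ioo (-1 : ℝ) 1) (hne : y ≠ y') :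
    |dy ω (x, y) - dy ω (x, y')| ≤ ε * |y - y'| ^ α := by
  have hz : (x, y) ∈ openChannel := mem_openChannel.2 hy
  have hz' : (x, y') ∈ openChannel := mem_openChannel.2 hy'
  have hne' : (x, y) ≠ (x, y') := fun h => hne (Prod.ext_iff.1 h).2
  have h1 : ENNReal.ofReal (euclid (grad ω (x, y) - grad ω (x, y')) /
      euclid ((x, y) - (x, y')) ^ α) ≤ ENNReal.ofReal ε := by
    refine le_trans ?_ h
    refine le_trans ?_ le_add_self
    refine le_trans ?_ (le_iSup₂ (x, y) hz)
    refine le_trans ?_ (le_iSup₂ (x, y') hz')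
    exact le_iSup (fun _ : (x, y) ≠ (x, y') => ENNReal.ofReal
      (euclid (grad ω (x, y) - grad ω (x, y')) / euclid ((x, y) - (x, y')) ^ α)) hne'
  have h2 := (ENNReal.ofReal_le_ofReal_iff hε).1 h1
  have h3 : euclid ((x, y) - (x, y')) = |y - y'| := by
    simp [euclid, Real.sqrt_sq_eq_abs]
  rw [h3, div_le_iff₀ (Real.rpow_pos_of_pos (abs_pos.2 (sub_ne_zero.2 hne)) α)] at h2
  exact (abs_snd_le_euclid (grad ω (x, y) - grad ω (x, y'))).trans h2

end Bounds

/-- The steady equation satisfied by the profile of a traveling wave. -/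
lemma IsTravelingWave.exists_stream {c : ℝ} {ω : ℝ × ℝ → ℝ} (h : IsTravelingWave c ω)
    (hω : ContDiffOn ℝ 1 ω openChannel) : ∃ ψ, IsStreamFunction ω ψ ∧ ∀ z ∈ openChannel,
      (z.2 - c + dy ψ z) * dx ω z = dx ψ z * dy ω z := by
  obtain ⟨-, ψ, hψ, heq⟩ := h
  have e : (fun z : ℝ × ℝ => ω (z.1 - c * 0, z.2)) = ω := by
    funext z; simp
  have h0 := hψ 0
  simp only [e] at h0
  refine ⟨ψ 0, h0, fun z hz => ?_⟩
  have h1 := heq 0 z hz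
  simp only [e, velocity] at h1
  -- At time 0 the wave is its own profile, and the time derivative becomes the transport term -c
  -- ∂ₓω.
  have hd : HasDerivAt (fun τ : ℝ => ω (z.1 - c * τ, z.2)) (-c * dx ω z) 0 := by
    have hdz : DifferentiableAt ℝ ω z :=
      (hω.differentiableOn (by norm_num)).differentiableAt (isOpen_openChannel.mem_nhds hz)
    have hline := hasDerivAt_line (f := ω) (z := z) (v := (-c, 0)) (t := 0) (by simpa using hdz)
    have e1 : (fun τ : ℝ => ω (z.1 - c * τ, z.2)) = fun s : ℝ => ω (z + s • (-c, (0 : ℝ))) := by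
      funext s
      congr 1
      ext
      · simp; ring
      · simp
    have e2 : dir (-c, 0) ω (z + (0 : ℝ) • (-c, (0 : ℝ))) = -c * dx ω z := by
      have : ((-c, 0) : ℝ × ℝ) = (-c) • (1, 0) := by simp
      rw [zero_smul, add_zero, dir, this, map_smul, smul_eq_mul, dx]
    rw [e1, ← e2]
    exact hline
  rw [hd.deriv] at h1
  linarith

/-! ### Absorption and conclusion -/

section Rigidity

variable {α ε c : ℝ} {ω ψ : ℝ × ℝ → ℝ}

/-- The cutoff depends on x alone, so it is constant on each slice and the slice inequality
integrates against it. Both sides therefore carry the same cutoff, which makes the absorption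
possible. -/
lemma lintegral_cutoff_mul_abs_le (hψ : IsStreamFunction ω ψ) (hω : ContDiffOn ℝ 1 ω openChannel)
    (hε : 0 < ε) (hε4 : ε ≤ 1 / 4) (hn : holderNorm α ω ≤ ENNReal.ofReal ε)
    (heq : ∀ z ∈ openChannel, (z.2 - c + dy ψ z) * dx ω z = dx ψ z * dy ω z)
    (hα : 0 < α) (a b : ℝ) :
    ∫⁻ z in openChannel, ENNReal.ofReal (cutoff a b z.1 * |dx ψ z * dx ω z|) ≤
      ENNReal.ofReal (4 * ε) * sliceConst α * ∫⁻ z in openChannel, ENNReal.ofReal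
        (cutoff a b z.1 * (dx (dx ψ) z ^ 2 + dy (dx ψ) z ^ 2)) := by
  have hdx : ∀ z ∈ openChannel, |dx ω z| ≤ ε := fun z hz =>
    (abs_fst_le_euclid (grad ω z)).trans (euclid_grad_le_of_holderNorm_le hε.le hn hz)
  have hdy : ∀ z ∈ openChannel, |dy ω z| ≤ ε := fun z hz =>
    (abs_snd_le_euclid (grad ω z)).trans (euclid_grad_le_of_holderNorm_le hε.le hn hz)
  have hsup : ∀ z ∈ openChannel, |ω z| ≤ ε := fun z hz =>
    abs_le_of_holderNorm_le hε.le hn (openChannel_subset_channel hz)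
  have hφ := contDiffOn_dx_stream hψ
  have hcut : ContinuousOn (fun z : ℝ × ℝ => cutoff a b z.1) openChannel :=
    ((contDiff_cutoff a b).continuous.comp continuous_fst).continuousOn
  have hmem : ∀ {x y : ℝ}, y ∈ Ioo (-1 : ℝ) 1 → (x, y) ∈ openChannel := fun hy =>
    mem_openChannel.2 hy
  have hslice : ∀ x : ℝ, ∫⁻ y in Ioo (-1 : ℝ) 1, ENNReal.ofReal |dx ψ (x, y) * dx ω (x, y)| ≤
      ENNReal.ofReal (4 * ε) * sliceConst α *
        ∫⁻ y in Ioo (-1 : ℝ) 1, ENNReal.ofReal (dy (dx ψ) (x, y) ^ 2) := by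
    intro x
    refine slice_inequality (f := fun y => dx ψ (x, y)) (f' := fun y => dy (dx ψ) (x, y))
      (p := fun y => y - c + dy ψ (x, y)) (p' := fun y => 1 + dy (dy ψ) (x, y))
      (q := fun y => dx ω (x, y)) (r := fun y => dy ω (x, y)) (C := ε / 2) hε
      (fun y hy => hasDerivAt_vertical hφ hy)
      ((continuousOn_dir hφ (0, 1)).comp (by fun_prop) fun y hy => hmem hy)
      (fun y hy => ?_) (fun y hy => ?_) (fun y hy => ?_) (fun y hy => heq _ (hmem hy))
      (fun y hy => hdy _ (hmem hy))
      (fun y hy y' hy' hne => abs_dy_sub_le_of_holderNorm_le hε.le hn hy hy' hne)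
    · have := abs_dx_stream_le hψ hω hdx (hmem (x := x) hy)
      simp only at this
      linarith
    · exact ((hasDerivAt_id y).sub_const c).add (hasDerivAt_vertical (contDiffOn_dy_stream hψ) hy)
    -- The bound ε ≤ 1/4 enters here: 1 + ∂_y²ψ ≥ 1 - 2ε ≥ 1/2.
    · have := (abs_le.1 (abs_dy_dy_stream_le hψ hω hsup hdx (hmem (x := x) hy))).1
      linarith
  have hk : ENNReal.ofReal (4 * ε) * sliceConst α ≠ ∞ :=
    ENNReal.mul_ne_top ENNReal.ofReal_ne_top (sliceConst_ne_top hα)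
  have h1 : ContinuousOn (fun z => cutoff a b z.1 * |dx ψ z * dx ω z|) openChannel :=
    hcut.mul (hφ.continuousOn.mul (continuousOn_dir hω (1, 0))).abs
  have h2 : ContinuousOn (fun z => cutoff a b z.1 * (dx (dx ψ) z ^ 2 + dy (dx ψ) z ^ 2))
      openChannel :=
    hcut.mul (((continuousOn_dir hφ (1, 0)).pow 2).add ((continuousOn_dir hφ (0, 1)).pow 2))
  rw [lintegral_openChannel h1, lintegral_openChannel h2, ← lintegral_const_mul' _ _ hk]
  refine lintegral_mono fun x => ?_
  simp only [ENNReal.ofReal_mul (cutoff_nonneg a b x)]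
  rw [lintegral_const_mul' _ _ ENNReal.ofReal_ne_top, lintegral_const_mul' _ _ ENNReal.ofReal_ne_top,
    mul_left_comm]
  refine mul_le_mul_right ((hslice x).trans ?_) _
  refine mul_le_mul_right (lintegral_mono fun y => ENNReal.ofReal_le_ofReal ?_) _
  nlinarith [sq_nonneg (dx (dx ψ) (x, y))]

lemma lintegral_cutoff_mul_abs_ne_top (hψ : IsStreamFunction ω ψ)
    (hω : ContDiffOn ℝ 1 ω openChannel) (hε : 0 ≤ ε) (hdx : ∀ z ∈ openChannel, |dx ω z| ≤ ε)
    {R : ℝ} (hR : 0 < R) :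
    ∫⁻ z in openChannel, ENNReal.ofReal (cutoff 2 (R⁻¹ ^ 2) z.1 * |dx ψ z * dx ω z|) ≠ ∞ := by
  set S := Icc (-(2 * R)) (2 * R) ×ˢ Icc (-1 : ℝ) 1 with hS
  have hSm : MeasurableSet S := measurableSet_Icc.prod measurableSet_Icc
  have hSc : IsCompact S := isCompact_Icc.prod isCompact_Icc
  have hb : ∀ z ∈ openChannel, ENNReal.ofReal (cutoff 2 (R⁻¹ ^ 2) z.1 * |dx ψ z * dx ω z|) ≤
      S.indicator (fun _ => ENNReal.ofReal (ε * ε)) z := by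
    intro z hz
    have hzc := mem_channel.1 (openChannel_subset_channel hz)
    by_cases hx : z.1 ∈ Icc (-(2 * R)) (2 * R)
    · rw [indicator_of_mem (show z ∈ S from ⟨hx, hzc⟩)]
      refine ENNReal.ofReal_le_ofReal ?_
      have h1 := abs_dx_stream_le hψ hω hdx hz
      have h2 : |dx ψ z| ≤ ε := by nlinarith [mul_nonneg hε (sq_nonneg z.2)]
      refine (mul_le_of_le_one_left (abs_nonneg _) (cutoff_le_one _ _ _)).trans ?_
      rw [abs_mul]
      exact mul_le_mul h2 (hdx z hz) (abs_nonneg _) hε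
    · have hx2 : 2 - R⁻¹ ^ 2 * z.1 ^ 2 ≤ 0 := by
        by_contra! h
        exact hx (mem_Icc_of_sq_le hR (sq_le_of_cutoff_arg_nonneg hR h.le))
      rw [cutoff, Real.smoothTransition.zero_of_nonpos hx2, zero_mul, ENNReal.ofReal_zero]
      exact zero_le
  refine ne_top_of_le_ne_top ?_ ((setLIntegral_mono' isOpen_openChannel.measurableSet hb).trans
    (setLIntegral_le_lintegral _ _))
  rw [lintegral_indicator_const hSm]
  exact ENNReal.mul_ne_top ENNReal.ofReal_ne_top hSc.measure_lt_top.ne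

/-- The truncated energy D satisfies D ≤ D/2 + O(1/R), hence D = O(1/R). Letting R grow kills the
gradient of φ almost everywhere, and everywhere by continuity; the vertical part alone is needed
afterwards. -/
lemma dy_dx_stream_eq_zero (hψ : IsStreamFunction ω ψ) (hω : ContDiffOn ℝ 1 ω openChannel)
    (hε : 0 < ε) (hε4 : ε ≤ 1 / 4) (hn : holderNorm α ω ≤ ENNReal.ofReal ε)
    (heq : ∀ z ∈ openChannel, (z.2 - c + dy ψ z) * dx ω z = dx ψ z * dy ω z)
    (hα : 0 < α) (hk : 4 * ε * (sliceConst α).toReal ≤ 1 / 2) {z : ℝ × ℝ} (hz : z ∈ openChannel) :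
    dy (dx ψ) z = 0 := by
  obtain ⟨C, hC0, hC⟩ := exists_smoothTransition_bound
  have hdx : ∀ z ∈ openChannel, |dx ω z| ≤ ε := fun z hz =>
    (abs_fst_le_euclid (grad ω z)).trans (euclid_grad_le_of_holderNorm_le hε.le hn hz)
  have hφ := contDiffOn_dx_stream hψ
  have hUm := isOpen_openChannel.measurableSet
  set F : ℕ → ℝ × ℝ → ℝ≥0∞ := fun n z => ENNReal.ofReal
    (cutoff 2 ((n + 1 : ℝ)⁻¹ ^ 2) z.1 * (dx (dx ψ) z ^ 2 + dy (dx ψ) z ^ 2)) with hF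
  have hle : ∀ n : ℕ, ∫⁻ z in openChannel, F n z ≤
      ENNReal.ofReal (160 * C * ε ^ 2 / (n + 1)) := by
    intro n
    have hR : (0 : ℝ) < n + 1 := by positivity
    have h1 := energy_inequality hψ hω hε.le hdx hC0 hC hR
    have h2 := lintegral_cutoff_mul_abs_le hψ hω hε hε4 hn heq hα 2 ((n + 1 : ℝ)⁻¹ ^ 2)
    have h3 := lintegral_cutoff_mul_abs_ne_top hψ hω hε.le hdx hR
    set D := ∫⁻ z in openChannel, F n z with hD
    -- Finiteness of D must precede the absorption; it comes from the crude bound on the source term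
    -- over the support of the cutoff.
    have hDtop : D ≠ ∞ := ne_top_of_le_ne_top (ENNReal.add_ne_top.2 ⟨h3, ENNReal.ofReal_ne_top⟩) h1
    have h4 : D ≤ ENNReal.ofReal (4 * ε) * sliceConst α * D
        + ENNReal.ofReal (80 * C * ε ^ 2 / (n + 1)) := h1.trans (add_le_add h2 le_rfl)
    have hpos : 0 ≤ 80 * C * ε ^ 2 / (n + 1) := by positivity
    have hktop : ENNReal.ofReal (4 * ε) * sliceConst α * D ≠ ∞ :=
      ENNReal.mul_ne_top (ENNReal.mul_ne_top ENNReal.ofReal_ne_top (sliceConst_ne_top hα)) hDtop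
    have h5 := ENNReal.toReal_mono (ENNReal.add_ne_top.2 ⟨hktop, ENNReal.ofReal_ne_top⟩) h4
    rw [ENNReal.toReal_add hktop ENNReal.ofReal_ne_top, ENNReal.toReal_mul, ENNReal.toReal_mul,
      ENNReal.toReal_ofReal (by positivity), ENNReal.toReal_ofReal hpos] at h5
    rw [← ENNReal.ofReal_toReal hDtop]
    refine ENNReal.ofReal_le_ofReal ?_
    have h6 := mul_le_mul_of_nonneg_right hk (ENNReal.toReal_nonneg (a := D))
    have e : 160 * C * ε ^ 2 / (n + 1 : ℝ) = 2 * (80 * C * ε ^ 2 / (n + 1)) := by ring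
    rw [e]
    linarith
  have hlim : Tendsto (fun n : ℕ => ENNReal.ofReal (160 * C * ε ^ 2 / (n + 1))) atTop (𝓝 0) := by
    rw [← ENNReal.ofReal_zero]
    refine ENNReal.tendsto_ofReal ?_
    have := (tendsto_one_div_add_atTop_nhds_zero_nat (𝕜 := ℝ)).const_mul (160 * C * ε ^ 2)
    simpa [div_eq_mul_inv] using this
  have hpt : ∀ z : ℝ × ℝ, liminf (fun n => F n z) atTop =
      ENNReal.ofReal (dx (dx ψ) z ^ 2 + dy (dx ψ) z ^ 2) := by
    intro z
    refine Tendsto.liminf_eq (tendsto_const_nhds.congr' ?_)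
    obtain ⟨N, hN⟩ := exists_nat_gt |z.1|
    filter_upwards [eventually_ge_atTop N] with n hn
    have hn' : (N : ℝ) ≤ n := by exact_mod_cast hn
    have h4 : cutoff 2 ((n + 1 : ℝ)⁻¹ ^ 2) z.1 = 1 := by
      refine Real.smoothTransition.one_of_one_le ?_
      have hp : (0 : ℝ) < n + 1 := by positivity
      have h5 : |(n + 1 : ℝ)⁻¹ * z.1| ≤ 1 := by
        rw [abs_mul, abs_of_pos (inv_pos.2 hp), inv_mul_le_iff₀ hp]
        linarith
      have h6 : ((n + 1 : ℝ)⁻¹ * z.1) ^ 2 ≤ 1 := (sq_le_one_iff_abs_le_one _).2 h5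
      rw [mul_pow] at h6
      linarith
    simp only [hF, h4, one_mul]
  have hcont : ContinuousOn (fun z => dx (dx ψ) z ^ 2 + dy (dx ψ) z ^ 2) openChannel :=
    ((continuousOn_dir hφ (1, 0)).pow 2).add ((continuousOn_dir hφ (0, 1)).pow 2)
  have hzero : ∫⁻ z in openChannel, ENNReal.ofReal (dx (dx ψ) z ^ 2 + dy (dx ψ) z ^ 2) = 0 := by
    refine le_antisymm ?_ zero_le
    calc ∫⁻ z in openChannel, ENNReal.ofReal (dx (dx ψ) z ^ 2 + dy (dx ψ) z ^ 2)
        = ∫⁻ z in openChannel, liminf (fun n => F n z) atTop := by simp only [hpt]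
      _ ≤ liminf (fun n => ∫⁻ z in openChannel, F n z) atTop :=
          lintegral_liminf_le' fun n => ((((contDiff_cutoff _ _).continuous.comp
            continuous_fst).continuousOn.mul hcont).aemeasurable hUm).ennreal_ofReal
      _ ≤ liminf (fun n : ℕ => ENNReal.ofReal (160 * C * ε ^ 2 / (n + 1))) atTop :=
          liminf_le_liminf (Eventually.of_forall hle)
      _ = 0 := hlim.liminf_eq
  have hae : (fun z => dx (dx ψ) z ^ 2 + dy (dx ψ) z ^ 2) =ᵐ[volume.restrict openChannel]
      fun _ => 0 := by
    have := (lintegral_eq_zero_iff' (hcont.aemeasurable hUm).ennreal_ofReal).1 hzero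
    filter_upwards [this] with z hz
    exact le_antisymm (ENNReal.ofReal_eq_zero.1 hz) (by positivity)
  have := Measure.eqOn_open_of_ae_eq hae isOpen_openChannel hcont continuousOn_const hz
  simp only at this
  nlinarith [sq_nonneg (dx (dx ψ) z), sq_nonneg (dy (dx ψ) z)]

/-- φ is constant on each vertical line and tends to 0 at the wall. -/
lemma dx_stream_eq_zero (hψ : IsStreamFunction ω ψ) (hω : ContDiffOn ℝ 1 ω openChannel)
    (hdx : ∀ z ∈ openChannel, |dx ω z| ≤ ε) (h : ∀ z ∈ openChannel, dy (dx ψ) z = 0)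
    {z : ℝ × ℝ} (hz : z ∈ openChannel) : dx ψ z = 0 := by
  obtain ⟨x, y⟩ := z
  have hφ := contDiffOn_dx_stream hψ
  have hconst : ∀ y' ∈ Ioo (-1 : ℝ) 1, dx ψ (x, y) = dx ψ (x, y') := by
    intro y' hy'
    refine isOpen_Ioo.is_const_of_deriv_eq_zero (f := fun s => dx ψ (x, s)) isPreconnected_Ioo
      (fun s hs => (hasDerivAt_vertical hφ hs).differentiableAt.differentiableWithinAt)
      (fun s hs => ?_) (mem_openChannel.1 hz) hy'
    rw [(hasDerivAt_vertical hφ hs).deriv, h (x, s) (mem_openChannel.2 hs)]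
    rfl
  have hlim : Tendsto (fun s : ℝ => ε * (1 - s ^ 2) / 2) (𝓝[<] 1) (𝓝 (ε * (1 - 1 ^ 2) / 2)) :=
    ((by fun_prop : Continuous fun s : ℝ => ε * (1 - s ^ 2) / 2).tendsto 1).mono_left
      nhdsWithin_le_nhds
  have hle : |dx ψ (x, y)| ≤ ε * (1 - 1 ^ 2) / 2 := by
    refine ge_of_tendsto hlim ?_
    filter_upwards [Ioo_mem_nhdsLT (show (-1 : ℝ) < 1 by norm_num)] with s hs
    rw [hconst s hs]
    exact abs_dx_stream_le hψ hω hdx (mem_openChannel.2 hs)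
  norm_num at hle
  exact hle

lemma shift_vorticity_eq (hψ : IsStreamFunction ω ψ) (h : ∀ z ∈ openChannel, dx ψ z = 0) (t : ℝ)
    {z : ℝ × ℝ} (hz : z ∈ openChannel) : ω (z + (t, 0)) = ω z := by
  have hψ1 : ContDiffOn ℝ 1 ψ openChannel := hψ.contDiffOn.of_le (by norm_num)
  have hconst : EqOn (fun x => ψ (x + (t, 0)) - ψ x) (fun _ => 0) openChannel := by
    intro x hx
    have e : x + ((0 : ℝ), (0 : ℝ)) = x := add_zero x
    have := is_const_of_deriv_eq_zero (f := fun s : ℝ => ψ (x + (s, 0)))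
      (fun s => (hasDerivAt_horizontal hψ1 hx s).differentiableAt)
      (fun s => by rw [(hasDerivAt_horizontal hψ1 hx s).deriv, h _ (shift_mem_openChannel s hx)]) t 0
    simp only [e] at this
    simp [this]
  have h1 := lap_shift_sub hψ t hz
  have hdir : ∀ v, dir v (dir v (fun x => ψ (x + (t, 0)) - ψ x)) z = 0 := by
    intro v
    rw [dir_congr isOpen_openChannel (dir_congr isOpen_openChannel hconst v) v hz]
    have : dir v (fun _ : ℝ × ℝ => (0 : ℝ)) = fun _ => 0 := by
      funext x; simp [dir]
    rw [this, this]
  rw [lap, dx_eq_dir, dx_eq_dir, dy_eq_dir, dy_eq_dir, hdir, hdir] at h1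
  linarith

/-- By Fubini, the integral of ω² is the slice integral times the infinite length of the channel.
Square integrability is what excludes the shear flows ω = ω(y), which are all steady. -/
lemma eq_zero_of_shift_invariant (hc : ContinuousOn ω channel)
    (hL2 : MemLp ω 2 (volume.restrict channel))
    (h : ∀ (t : ℝ), ∀ z ∈ openChannel, ω (z + (t, 0)) = ω z) {z : ℝ × ℝ} (hz : z ∈ channel) :
    ω z = 0 := by
  have hco := hc.mono openChannel_subset_channel
  have hfin : ∫⁻ z in openChannel, ENNReal.ofReal (ω z ^ 2) ≠ ∞ :=
    (IntegrableOn.mono_set hL2.integrable_sq openChannel_subset_channel).lintegral_lt_top.ne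
  have hslice : ∀ x y : ℝ, y ∈ Ioo (-1 : ℝ) 1 → ω (x, y) = ω (0, y) := by
    intro x y hy
    have := h x (0, y) (mem_openChannel.2 hy)
    simpa using this
  have hcs : ContinuousOn (fun y => ω (0, y)) (Ioo (-1 : ℝ) 1) :=
    hco.comp (by fun_prop) fun y hy => mem_openChannel.2 hy
  have hzero : ∫⁻ y in Ioo (-1 : ℝ) 1, ENNReal.ofReal (ω (0, y) ^ 2) = 0 := by
    by_contra hne
    apply hfin
    rw [lintegral_openChannel (f := fun z => ω z ^ 2) (hco.pow 2)]
    have e : ∀ x : ℝ, ∫⁻ y in Ioo (-1 : ℝ) 1, ENNReal.ofReal (ω (x, y) ^ 2) =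
        ∫⁻ y in Ioo (-1 : ℝ) 1, ENNReal.ofReal (ω (0, y) ^ 2) := fun x =>
      setLIntegral_congr_fun measurableSet_Ioo fun y hy => by simp only [hslice x y hy]
    simp only [e]
    rw [lintegral_const, Real.volume_univ, ENNReal.mul_top hne]
  have hae : (fun y => ω (0, y)) =ᵐ[volume.restrict (Ioo (-1 : ℝ) 1)] fun _ => 0 := by
    have := (lintegral_eq_zero_iff'
      ((hcs.pow 2).aemeasurable measurableSet_Ioo).ennreal_ofReal).1 hzero
    filter_upwards [this] with y hy
    exact pow_eq_zero_iff two_ne_zero |>.1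
      (le_antisymm (ENNReal.ofReal_eq_zero.1 hy) (sq_nonneg _))
  have hIoo := Measure.eqOn_open_of_ae_eq hae isOpen_Ioo hcs continuousOn_const
  have hopen : EqOn ω (fun _ => 0) openChannel := by
    rintro ⟨x, y⟩ hxy
    rw [hslice x y (mem_openChannel.1 hxy)]
    exact hIoo (mem_openChannel.1 hxy)
  refine hopen.of_subset_closure hc continuousOn_const openChannel_subset_channel ?_ hz
  rw [openChannel, closure_prod_eq, closure_univ, closure_Ioo (by norm_num)]
  exact subset_rfl

end Rigidity

end Couette

end

theorem mainTheorem5 (α : ℝ) (hα : 0 < α) :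
    ∃ ε : ℝ, 0 < ε ∧ ∀ (c : ℝ) (ω : ℝ × ℝ → ℝ),
      MemLp ω 2 (volume.restrict Couette.channel) →
      Couette.MemHolder α ω →
      Couette.IsTravelingWave c ω →
      Couette.holderNorm α ω ≤ ENNReal.ofReal ε →
      ∀ z ∈ Couette.channel, ω z = 0 := by
  set K := (Couette.sliceConst α).toReal with hK
  have hK0 : 0 ≤ K := ENNReal.toReal_nonneg
  -- The first bound gives p' ≥ 1/2. The second makes the absorption factor 4εK at most 1/2, with K
  -- + 1 avoiding a division by zero.
  have hpos : 0 < min (1 / 4) (1 / (8 * (K + 1))) := by positivity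
  refine ⟨min (1 / 4) (1 / (8 * (K + 1))), hpos, ?_⟩
  generalize hε : min (1 / 4) (1 / (8 * (K + 1))) = ε at hpos
  intro c ω hL2 hω htw hn z hz
  have hε4 : ε ≤ 1 / 4 := hε ▸ min_le_left _ _
  have hk : 4 * ε * K ≤ 1 / 2 := by
    have h1 : ε ≤ 1 / (8 * (K + 1)) := hε ▸ min_le_right _ _
    rw [le_div_iff₀ (by positivity)] at h1
    nlinarith
  obtain ⟨ψ, hψ, heq⟩ := htw.exists_stream hω.contDiffOn
  have hdx : ∀ z ∈ Couette.openChannel, |Couette.dx ω z| ≤ ε := fun z hz =>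
    (Couette.abs_fst_le_euclid (Couette.grad ω z)).trans
      (Couette.euclid_grad_le_of_holderNorm_le hpos.le hn hz)
  have hφ : ∀ z ∈ Couette.openChannel, Couette.dx ψ z = 0 := fun z hz =>
    Couette.dx_stream_eq_zero hψ hω.contDiffOn hdx
      (fun z hz => Couette.dy_dx_stream_eq_zero hψ hω.contDiffOn hpos hε4 hn heq hα hk hz) hz
  exact Couette.eq_zero_of_shift_invariant hω.continuousOn hL2
    (fun t z hz => Couette.shift_vorticity_eq hψ hφ t hz) hz
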